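/- For integers $N\ge 1$ and $1\le k\le N$ put $$h_k=1-\frac{2k-1}{N},\qquad \phi_k=\arccos h_k,\qquad \theta_k=\sqrt{N\pi}\,\phi_k,$$ and let $\omega_N=\{x_1,\dots,x_N\}\subset\mathbb S^2$ be the configuration of generalized spiral points, where $x_k=(\sin\phi_k\cos\theta_k,\ \sin\phi_k\sin\theta_k,\ \cos\phi_k)$ is the point with polar angle $\phi_k$ and azimuth $\theta_k$. For a finite set $\omega\subset\mathbb S^2$ with at least two points let $$\delta(\omega)=\min_{x,y\in\omega,\ x\ne y}|x-y|,\qquad \eta(\omega)=\max_{y\in\mathbb S^2}\min_{x\in\omega}|x-y|,$$ with $|\cdot|$ the Euclidean norm of $\mathbb R^3$. Then: 1. $\omega_N$ has exactly $N$ points for every $N\ge 1$, and the sequence $\{\omega_N\}_{N\ge1}$ is equidistributed: for every continuous $f:\mathbb S^2\to\mathbb R$, $$\lim_{N\to\infty}\frac1N\sum_{x\in\omega_N}f(x)=\int_{\mathbb S^2}f\,d\sigma,$$ where $\sigma$ is the normalized surface area measure on $\mathbb S^2$. 2. The sequence is quasi-uniform: the mesh ratios $\eta(\omega_N)/\delta(\omega_N)$,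 $N\ge 2$, are bounded. 3. The separation satisfies $$\lim_{N\to\infty}\sqrt N\,\delta(\omega_N)=\sqrt{8-4\sqrt3\cos\bigl(\sqrt{2\pi}\,(1-\sqrt3)\bigr)}\approx 3.131948,$$ where the decimal value is correct to within $5\cdot10^{-7}$. -/

import Mathlib

open MeasureTheory Filter Topology
open scoped ENNReal

/-- The unit sphere `𝕊²` in Euclidean space `ℝ³`; its distance is the chordal distance `|x - y|`. -/
abbrev S2 : Type := Metric.sphere (0 : EuclideanSpace ℝ (Fin 3)) 1

theorem sphericalCoords_mem (φ θ : ℝ) :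
    (!₂[Real.sin φ * Real.cos θ, Real.sin φ * Real.sin θ, Real.cos φ] :
      EuclideanSpace ℝ (Fin 3)) ∈ Metric.sphere (0 : EuclideanSpace ℝ (Fin 3)) 1 := by
  rw [mem_sphere_zero_iff_norm, EuclideanSpace.norm_eq, Real.sqrt_eq_one]
  simp only [Fin.sum_univ_three, Real.norm_eq_abs, sq_abs]
  simp
  nlinarith [Real.sin_sq_add_cos_sq φ, Real.sin_sq_add_cos_sq θ]

/-- The point of `𝕊²` with polar angle `φ` and azimuth `θ`. -/
noncomputable def sphericalCoords (φ θ : ℝ) : S2 :=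
  ⟨!₂[Real.sin φ * Real.cos θ, Real.sin φ * Real.sin θ, Real.cos φ], sphericalCoords_mem φ θ⟩

/-- The height `h_k = 1 - (2k - 1) / N`. -/
noncomputable def spiralHeight (N k : ℕ) : ℝ := 1 - (2 * (k : ℝ) - 1) / (N : ℝ)

/-- The polar angle `φ_k = arccos h_k`. -/
noncomputable def spiralPolar (N k : ℕ) : ℝ := Real.arccos (spiralHeight N k)

/-- The azimuth `θ_k = L φ_k` with `L = √(N π)`. -/
noncomputable def spiralAzimuth (N k : ℕ) : ℝ := Real.sqrt (N * Real.pi) * spiralPolar N k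

/-- The `k`-th generalized spiral point among `N`. -/
noncomputable def spiralPoint (N k : ℕ) : S2 :=
  sphericalCoords (spiralPolar N k) (spiralAzimuth N k)

open Classical in
/-- The generalized spiral configuration `ω_N = {x_1, …, x_N}`. -/
noncomputable def spiralConfig (N : ℕ) : Finset S2 :=
  (Finset.Icc 1 N).image (spiralPoint N)

/-- The normalized surface area measure `σ` on `𝕊²`. -/
noncomputable def sphereSigma : Measure S2 :=
  ((volume : Measure (EuclideanSpace ℝ (Fin 3))).toSphere Set.univ)⁻¹ •
    (volume : Measure (EuclideanSpace ℝ (Fin 3))).toSphere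

/-- The normalized counting measure `ν_N(A) = |A ∩ ω| / N` of an `N`-point configuration. -/
noncomputable def normalizedCounting (N : ℕ) (ω : Finset S2) : Measure S2 :=
  (N : ℝ≥0∞)⁻¹ • ∑ x ∈ ω, Measure.dirac x

/-- `ω_N` consists of exactly `N` points, for every `N ≥ 1`. -/
def IsConfigurationSequence (ω : ℕ → Finset S2) : Prop :=
  ∀ N : ℕ, 1 ≤ N → (ω N).card = N

/-- Equidistribution of a sequence of `N`-point configurations: the normalized counting measures
converge weak-star to `σ`. -/
def IsEquidistributed (ω : ℕ → Finset S2) : Prop :=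
  ∀ f : C(S2, ℝ),
    Tendsto (fun N : ℕ => ∫ x, f x ∂(normalizedCounting N (ω N))) atTop
      (𝓝 (∫ x, f x ∂sphereSigma))

/-- The separation `δ(ω) = min_{x ≠ y} |x - y|`. -/
noncomputable def separation (ω : Finset S2) : ℝ := Set.infsep (ω : Set S2)

/-- The covering radius `η(ω) = max_{y ∈ 𝕊²} min_{x ∈ ω} |x - y|`. -/
noncomputable def coveringRadius (ω : Finset S2) : ℝ := ⨆ y : S2, Metric.infDist y (ω : Set S2)

/-- The mesh ratio `γ(ω) = η(ω) / δ(ω)`. -/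
noncomputable def meshRatio (ω : Finset S2) : ℝ := coveringRadius ω / separation ω

/-- Quasi-uniformity of a sequence of `N`-point configurations: the mesh ratios are bounded over
`N ≥ 2`. -/
def IsQuasiUniform (ω : ℕ → Finset S2) : Prop :=
  ∃ C : ℝ, ∀ N : ℕ, 2 ≤ N → meshRatio (ω N) ≤ C

/-!
Write `L = √(Nπ)`. The configuration lies on the curve `t ↦ (t, L t)` in polar angle and azimuth, and
its heights are the midpoints of `N` equal intervals of `[-1, 1]`. Two facts about this curve carry
the global statements. A piece of it over a height interval of length `1 / N` has diameter at most
`4 / √N`, also near the poles (`dist_spiralCurve_le`), and its consecutive turns are `2π / L` apart;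
so the covering radius is at most `8 / √N`.

*Separation.* For the points with indices `i < j = i + n` let `δ` be half the difference of their
polar angles, `x = N sin² δ` and `P = N sin φ_i sin φ_j`. Then
`N |x_i - x_j|² = 4 (x + P sin² (L δ))`, and equal spacing of the heights gives `x (P + x) = n²`
(`polarPart_mul_add`). Moreover `L δ` is nearly `√(π x)` unless `x` is so large that the points are
far apart anyway. So the distance is essentially a function of `n` and `x`. For `n ≥ 2` it exceeds
the claimed limit by elementary inequalities (`lower_bound_of_not_consecutive`). For `n = 1` it
decreases in `x` (`antitoneOn_consecutiveProfile`), and `x` is largest for the two points nearest to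
a pole. Hence the separation is asymptotically `|x_1 - x_2|`, for which `x → 2 - √3` and `P → 2√3`.
Quasi-uniformity follows, since only finitely many `N` escape the asymptotic bounds.

*Equidistribution.* By the diameter bound, `(1/N) ∑ f(x_k)` differs by `o(1)` from
`(1/2) ∫ f(t, L t) sin t dt`. As `L → ∞` the azimuth `L t` is averaged out
(`tendsto_integral_line`): shifting the azimuth by `s` amounts to a translation of `t` by `s / L`,
and averaging over `s` gives the mean over a full period. The limit is the integral against the
surface measure, which `toSphere_eq_map_angleMeasure` identifies with `sin φ dφ dθ`.
-/

/-! ### The spiral curve and the covering radius -/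

theorem dist_sphericalCoords_sq (φ θ φ' θ' : ℝ) :
    dist (sphericalCoords φ θ) (sphericalCoords φ' θ') ^ 2 =
      4 * Real.sin ((φ - φ') / 2) ^ 2 +
        4 * (Real.sin φ * Real.sin φ') * Real.sin ((θ - θ') / 2) ^ 2 := by
  rw [Subtype.dist_eq, EuclideanSpace.dist_eq, Real.sq_sqrt (by positivity)]
  simp only [sphericalCoords, Fin.sum_univ_three, Real.dist_eq, sq_abs]
  simp only [Real.sin_sq_eq_half_sub ((φ - φ') / 2), Real.sin_sq_eq_half_sub ((θ - θ') / 2)]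
  rw [show 2 * ((φ - φ') / 2) = φ - φ' by ring, show 2 * ((θ - θ') / 2) = θ - θ' by ring,
    Real.cos_sub, Real.cos_sub]
  simp
  linear_combination (Real.sin φ ^ 2) * Real.sin_sq_add_cos_sq θ
    + (Real.sin φ' ^ 2) * Real.sin_sq_add_cos_sq θ' + Real.sin_sq_add_cos_sq φ
    + Real.sin_sq_add_cos_sq φ'

/-- The spherical spiral on which the generalized spiral points lie, parametrized by the polar
angle. -/
noncomputable def spiralCurve (N : ℕ) (t : ℝ) : S2 :=
  sphericalCoords t (Real.sqrt (N * Real.pi) * t)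

theorem spiralPoint_eq_spiralCurve (N k : ℕ) :
    spiralPoint N k = spiralCurve N (spiralPolar N k) := rfl

theorem spiralHeight_mem {N k : ℕ} (hk : k ∈ Finset.Icc 1 N) :
    spiralHeight N k ∈ Set.Ioo (-1 : ℝ) 1 := by
  rw [Finset.mem_Icc] at hk
  have h1 : (1 : ℝ) ≤ k := by exact_mod_cast hk.1
  have h2 : (k : ℝ) ≤ N := by exact_mod_cast hk.2
  have hN : (0 : ℝ) < N := by linarith
  unfold spiralHeight
  constructor
  · have : (2 * (k : ℝ) - 1) / N < 2 := by rw [div_lt_iff₀ hN]; linarith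
    linarith
  · have : 0 < (2 * (k : ℝ) - 1) / N := div_pos (by linarith) hN
    linarith

theorem cos_spiralPolar {N k : ℕ} (hk : k ∈ Finset.Icc 1 N) :
    Real.cos (spiralPolar N k) = spiralHeight N k :=
  Real.cos_arccos (spiralHeight_mem hk).1.le (spiralHeight_mem hk).2.le

theorem spiralPolar_mem (N k : ℕ) : spiralPolar N k ∈ Set.Icc 0 Real.pi :=
  ⟨Real.arccos_nonneg _, Real.arccos_le_pi _⟩

theorem spiralPoint_apply_two {N k : ℕ} (hk : k ∈ Finset.Icc 1 N) :
    (spiralPoint N k).1 2 = spiralHeight N k := by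
  rw [← cos_spiralPolar hk]
  simp [spiralPoint, sphericalCoords]

theorem injOn_spiralPoint (N : ℕ) : Set.InjOn (spiralPoint N) (Finset.Icc 1 N) := by
  intro i hi j hj h
  have h2 := congrArg (fun x : S2 => x.1 2) h
  simp only [spiralPoint_apply_two hi, spiralPoint_apply_two hj, spiralHeight] at h2
  have hN : (N : ℝ) ≠ 0 := by
    have := (Finset.mem_Icc.1 hi)
    exact_mod_cast (by omega : N ≠ 0)
  field_simp at h2
  exact_mod_cast (by linarith : (i : ℝ) = j)

theorem spiralPoint_mem_spiralConfig {N k : ℕ} (hk : k ∈ Finset.Icc 1 N) :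
    spiralPoint N k ∈ (spiralConfig N : Set S2) := by
  classical
  rw [spiralConfig, Finset.mem_coe]
  exact Finset.mem_image_of_mem _ hk

theorem card_spiralConfig (N : ℕ) : (spiralConfig N).card = N := by
  classical
  unfold spiralConfig
  rw [Finset.card_image_of_injOn (injOn_spiralPoint N), Nat.card_Icc]
  simp

theorem sin_mul_sin_eq_sq_sub_sq (s t : ℝ) :
    Real.sin s * Real.sin t = Real.sin ((s + t) / 2) ^ 2 - Real.sin ((s - t) / 2) ^ 2 := by
  rw [Real.sin_sq_eq_half_sub, Real.sin_sq_eq_half_sub,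
    show 2 * ((s + t) / 2) = s + t by ring, show 2 * ((s - t) / 2) = s - t by ring,
    Real.cos_add, Real.cos_sub]
  ring

theorem dist_spiralCurve_sq (N : ℕ) (s t : ℝ) :
    dist (spiralCurve N s) (spiralCurve N t) ^ 2 =
      4 * Real.sin ((s - t) / 2) ^ 2 +
        4 * (Real.sin s * Real.sin t) * Real.sin (Real.sqrt (N * Real.pi) * ((s - t) / 2)) ^ 2 := by
  unfold spiralCurve
  rw [dist_sphericalCoords_sq, ← mul_sub, mul_div_assoc]

/-- The pieces of the spiral over a height interval of length `1 / N` have diameter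
`O(1 / √N)`, uniformly up to the poles. -/
theorem dist_spiralCurve_le {N : ℕ} (hN : 1 ≤ N) {s t : ℝ} (hs : s ∈ Set.Icc 0 Real.pi)
    (ht : t ∈ Set.Icc 0 Real.pi) (h : |Real.cos s - Real.cos t| ≤ 1 / N) :
    dist (spiralCurve N s) (spiralCurve N t) ≤ 4 / Real.sqrt N := by
  wlog hst : t ≤ s generalizing s t
  · rw [dist_comm]
    exact this ht hs (by rwa [abs_sub_comm]) (le_of_not_ge hst)
  have hN0 : (0 : ℝ) < N := by exact_mod_cast hN
  set m := (s + t) / 2 with hm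
  set d := (s - t) / 2 with hd
  have hpi := Real.pi_pos
  have hd0 : 0 ≤ d := by rw [hd]; linarith
  have hdpi : d ≤ Real.pi / 2 := by rw [hd]; linarith [hs.2, ht.1]
  have hsd : 0 ≤ Real.sin d := Real.sin_nonneg_of_nonneg_of_le_pi hd0 (by linarith)
  have hsm : 0 ≤ Real.sin m := Real.sin_nonneg_of_nonneg_of_le_pi
    (by rw [hm]; linarith [hs.1, ht.1]) (by rw [hm]; linarith [hs.2, ht.2])
  have hss : 0 ≤ Real.sin s * Real.sin t := mul_nonneg
    (Real.sin_nonneg_of_nonneg_of_le_pi hs.1 hs.2) (Real.sin_nonneg_of_nonneg_of_le_pi ht.1 ht.2)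
  have hprod : Real.sin s * Real.sin t = Real.sin m ^ 2 - Real.sin d ^ 2 :=
    sin_mul_sin_eq_sq_sub_sq s t
  have hdm : Real.sin d ≤ Real.sin m := by
    apply le_of_sq_le_sq _ hsm
    linarith
  rw [Real.cos_sub_cos, ← hm, ← hd] at h
  have hmd : Real.sin m * Real.sin d ≤ 1 / (2 * N) := by
    have h' := (neg_le_abs _).trans h
    have : (1 : ℝ) / (2 * N) = 1 / N / 2 := by field_simp
    rw [this]; linarith
  have hjordan : 2 / Real.pi * d ≤ Real.sin d := Real.mul_le_sin hd0 hdpi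
  have hd2 : d ≤ 1.6 * Real.sin d := by
    calc d = Real.pi / 2 * (2 / Real.pi * d) := by field_simp
      _ ≤ 1.6 * Real.sin d := by
          gcongr
          linarith [Real.pi_lt_d2]
  have hD : dist (spiralCurve N s) (spiralCurve N t) ^ 2 ≤ (4 / Real.sqrt N) ^ 2 := by
    rw [dist_spiralCurve_sq, ← hd, div_pow, Real.sq_sqrt hN0.le]
    have h1 : Real.sin (Real.sqrt (N * Real.pi) * d) ^ 2 ≤ N * Real.pi * d ^ 2 := by
      refine Real.sin_sq_le_sq.trans_eq ?_
      rw [mul_pow, Real.sq_sqrt (by positivity)]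
    have h2 : Real.sin d ^ 2 ≤ 1 / (2 * N) := by nlinarith
    have h3 : Real.sin m * d ≤ 1.6 * (1 / (2 * N)) := by nlinarith
    have h4 : (Real.sin m * d) ^ 2 ≤ (1.6 * (1 / (2 * N))) ^ 2 :=
      pow_le_pow_left₀ (mul_nonneg hsm hd0) h3 2
    calc 4 * Real.sin d ^ 2 + 4 * (Real.sin s * Real.sin t) *
          Real.sin (Real.sqrt (N * Real.pi) * d) ^ 2
        ≤ 4 * (1 / (2 * N)) + 4 * Real.sin m ^ 2 * (N * Real.pi * d ^ 2) := by
          gcongr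
          rw [hprod]
          linarith [sq_nonneg (Real.sin d)]
      _ = 4 * (1 / (2 * N)) + 4 * N * Real.pi * (Real.sin m * d) ^ 2 := by ring
      _ ≤ 4 * (1 / (2 * N)) + 4 * N * Real.pi * (1.6 * (1 / (2 * N))) ^ 2 := by gcongr
      _ = (2 + 2.56 * Real.pi) / N := by field_simp; ring
      _ ≤ 4 ^ 2 / N := by
          gcongr
          linarith [Real.pi_lt_d2]
  exact le_of_sq_le_sq hD (by positivity)

/-- The height intervals `|h - h_k| ≤ 1 / N` cover `[-1, 1]`. -/
theorem exists_abs_cos_sub_spiralHeight_le {N : ℕ} (hN : 1 ≤ N) (t : ℝ) :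
    ∃ k ∈ Finset.Icc 1 N, |Real.cos t - spiralHeight N k| ≤ 1 / N := by
  have hN0 : (0 : ℝ) < N := by exact_mod_cast hN
  set x : ℝ := N * (1 - Real.cos t) / 2 with hx
  have hx0 : 0 ≤ x := by
    have := Real.cos_le_one t
    rw [hx]; apply div_nonneg (mul_nonneg hN0.le (by linarith)) (by norm_num)
  have hxN : x ≤ N := by
    have := Real.neg_one_le_cos t
    rw [hx]; nlinarith
  have hcos : Real.cos t = 1 - 2 * x / N := by rw [hx]; field_simp; ring
  obtain ⟨k, hk, h1, h2⟩ : ∃ k ∈ Finset.Icc 1 N, (k : ℝ) - 1 ≤ x ∧ x ≤ k := by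
    rcases hx0.eq_or_lt with h | h
    · exact ⟨1, by simp [hN], by simp [← h], by simp [← h]⟩
    · refine ⟨⌈x⌉₊, ?_, by linarith [Nat.ceil_lt_add_one hx0], Nat.le_ceil x⟩
      rw [Finset.mem_Icc]
      exact ⟨Nat.one_le_ceil_iff.2 h, Nat.ceil_le.2 hxN⟩
  refine ⟨k, hk, ?_⟩
  have : Real.cos t - spiralHeight N k = (2 * k - 1 - 2 * x) / N := by
    rw [hcos, spiralHeight]; field_simp; ring
  rw [this, abs_div, abs_of_pos hN0]
  gcongr
  rw [abs_le]
  constructor <;> linarith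

theorem exists_sphericalCoords_eq (y : S2) :
    ∃ φ ∈ Set.Icc 0 Real.pi, ∃ θ, y = sphericalCoords φ θ := by
  have hy : y.1 0 ^ 2 + y.1 1 ^ 2 + y.1 2 ^ 2 = 1 := by
    have h := y.2
    rw [mem_sphere_zero_iff_norm, EuclideanSpace.norm_eq, Real.sqrt_eq_one] at h
    simpa [Fin.sum_univ_three] using h
  have h1 : -1 ≤ y.1 2 := by nlinarith [sq_nonneg (y.1 0), sq_nonneg (y.1 1)]
  have h2 : y.1 2 ≤ 1 := by nlinarith [sq_nonneg (y.1 0), sq_nonneg (y.1 1)]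
  have hz : ‖(⟨y.1 0, y.1 1⟩ : ℂ)‖ = Real.sin (Real.arccos (y.1 2)) := by
    rw [Real.sin_arccos, Complex.norm_def, Complex.normSq_mk]
    congr 1
    linarith
  refine ⟨Real.arccos (y.1 2), ⟨Real.arccos_nonneg _, Real.arccos_le_pi _⟩,
    Complex.arg ⟨y.1 0, y.1 1⟩, ?_⟩
  apply Subtype.ext
  ext i
  fin_cases i
  · simp [sphericalCoords, ← hz, Complex.norm_mul_cos_arg]
  · simp [sphericalCoords, ← hz, Complex.norm_mul_sin_arg]
  · simp [sphericalCoords, Real.cos_arccos h1 h2]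

/-- The spiral meets the meridian of `y` once in every polar-angle interval of length
`2π / √(Nπ)`, the distance of consecutive turns. -/
theorem exists_dist_spiralCurve_le {N : ℕ} (hN : 2 ≤ N) (y : S2) :
    ∃ t ∈ Set.Icc 0 Real.pi, dist y (spiralCurve N t) ≤ 4 / Real.sqrt N := by
  obtain ⟨φ, hφ, θ, rfl⟩ := exists_sphericalCoords_eq y
  have hN0 : (2 : ℝ) ≤ N := by exact_mod_cast hN
  have hpi := Real.pi_gt_three
  have hpi' := Real.pi_lt_d2
  set L := Real.sqrt (N * Real.pi) with hL
  have hL2 : 2 ≤ L := Real.le_sqrt_of_sq_le (by nlinarith)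
  have hsN : 0 < Real.sqrt N := Real.sqrt_pos.2 (by linarith)
  have hturn : 2 * Real.pi / L ≤ 4 / Real.sqrt N := by
    have h1 : L = Real.sqrt N * Real.sqrt Real.pi := by rw [hL, Real.sqrt_mul (by linarith)]
    have h2 : 1.5 ≤ Real.sqrt Real.pi := Real.le_sqrt_of_sq_le (by linarith)
    have h3 : Real.sqrt Real.pi ^ 2 = Real.pi := Real.sq_sqrt (by linarith)
    have h4 : Real.sqrt Real.pi ≤ 2 := by nlinarith
    rw [h1, div_le_div_iff₀ (by positivity) hsN]
    nlinarith
  have hturn' : 2 * Real.pi / L ≤ Real.pi := by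
    rw [div_le_iff₀ (by linarith)]; nlinarith
  have hturn0 : 0 < 2 * Real.pi / L := by positivity
  obtain ⟨m, t, ht, htm, hφt⟩ : ∃ m : ℤ, ∃ t ∈ Set.Icc 0 Real.pi, L * t = θ + m * (2 * Real.pi) ∧
      |φ - t| ≤ 2 * Real.pi / L := by
    set m := ⌊(L * φ - θ) / (2 * Real.pi)⌋ with hm
    have h1 : (m : ℝ) * (2 * Real.pi) ≤ L * φ - θ :=
      (le_div_iff₀ (by positivity)).1 (Int.floor_le _)
    have h2 : L * φ - θ < (m + 1) * (2 * Real.pi) :=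
      (div_lt_iff₀ (by positivity)).1 (Int.lt_floor_add_one _)
    have e1 : (θ + m * (2 * Real.pi)) / L ≤ φ := by
      rw [div_le_iff₀ (by linarith)]; linarith
    have e2 : φ < (θ + m * (2 * Real.pi)) / L + 2 * Real.pi / L := by
      rw [← add_div, lt_div_iff₀ (by linarith)]; linarith
    by_cases hneg : 0 ≤ (θ + m * (2 * Real.pi)) / L
    · refine ⟨m, _, ⟨hneg, e1.trans hφ.2⟩, by field_simp, ?_⟩
      rw [abs_le]; constructor <;> linarith
    · push Not at hneg
      refine ⟨m + 1, (θ + m * (2 * Real.pi)) / L + 2 * Real.pi / L,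
        ⟨by linarith [hφ.1], by linarith⟩, by push_cast; field_simp; ring, ?_⟩
      rw [abs_le]; constructor <;> linarith [hφ.1]
  refine ⟨t, ht, ?_⟩
  have h0 : Real.sin ((θ - L * t) / 2) = 0 := by
    rw [htm, Real.sin_eq_zero_iff]
    exact ⟨-m, by push_cast; ring⟩
  have hdist : dist (sphericalCoords φ θ) (spiralCurve N t) ^ 2 ≤ (4 / Real.sqrt N) ^ 2 := by
    rw [spiralCurve, dist_sphericalCoords_sq, ← hL, h0]
    calc _ ≤ 4 * ((φ - t) / 2) ^ 2 + 0 := by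
          gcongr ?_ + ?_
          · gcongr 4 * ?_
            exact Real.sin_sq_le_sq
          · simp
      _ = |φ - t| ^ 2 := by rw [sq_abs]; ring
      _ ≤ _ := by
          gcongr
          exact hφt.trans hturn
  exact le_of_sq_le_sq hdist (by positivity)

theorem coveringRadius_spiralConfig_le {N : ℕ} (hN : 2 ≤ N) :
    coveringRadius (spiralConfig N) ≤ 8 / Real.sqrt N := by
  have : Nonempty S2 := ⟨sphericalCoords 0 0⟩
  refine ciSup_le fun y => ?_
  obtain ⟨t, ht, hyt⟩ := exists_dist_spiralCurve_le hN y
  obtain ⟨k, hk, hkt⟩ := exists_abs_cos_sub_spiralHeight_le (by omega : 1 ≤ N) t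
  rw [← cos_spiralPolar hk] at hkt
  have h := dist_spiralCurve_le (by omega) ht (spiralPolar_mem N k) hkt
  calc Metric.infDist y (spiralConfig N : Set S2) ≤ dist y (spiralPoint N k) :=
        Metric.infDist_le_dist_of_mem (spiralPoint_mem_spiralConfig hk)
    _ ≤ dist y (spiralCurve N t) + dist (spiralCurve N t) (spiralPoint N k) := dist_triangle _ _ _
    _ ≤ 4 / Real.sqrt N + 4 / Real.sqrt N := add_le_add hyt h
    _ = 8 / Real.sqrt N := by ring

/-! ### Elementary estimates for sine -/

theorem nonneg_of_deriv_nonneg_of_zero {f f' : ℝ → ℝ} (hf : ∀ x, HasDerivAt f (f' x) x)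
    (h0 : f 0 = 0) (hf' : ∀ x, 0 ≤ x → 0 ≤ f' x) {x : ℝ} (hx : 0 ≤ x) : 0 ≤ f x := by
  have hmono : MonotoneOn f (Set.Ici 0) := by
    apply monotoneOn_of_deriv_nonneg (convex_Ici 0)
      (fun x _ => (hf x).continuousAt.continuousWithinAt)
      (fun x _ => (hf x).differentiableAt.differentiableWithinAt)
    intro x hx
    rw [interior_Ici] at hx
    rw [(hf x).deriv]
    exact hf' x (le_of_lt hx)
  simpa [h0] using hmono Set.self_mem_Ici hx hx

theorem cos_le_taylor_four {x : ℝ} (hx : 0 ≤ x) :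
    Real.cos x ≤ 1 - x ^ 2 / 2 + x ^ 4 / 24 := by
  exact sub_nonneg.1 (nonneg_of_deriv_nonneg_of_zero
    (f := fun x => 1 - x ^ 2 / 2 + x ^ 4 / 24 - Real.cos x)
    (f' := fun x => Real.sin x - (x - x ^ 3 / 6))
    (fun x => ((((((hasDerivAt_id x).pow 2).div_const 2).const_sub 1).add
        (((hasDerivAt_id x).pow 4).div_const 24)).sub (Real.hasDerivAt_cos x)).congr_deriv
        (by simp; ring))
    (by simp) (fun x hx => by linarith [Real.sin_ge_sub_cube hx]) hx)

theorem sin_le_taylor_five {x : ℝ} (hx : 0 ≤ x) :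
    Real.sin x ≤ x - x ^ 3 / 6 + x ^ 5 / 120 := by
  exact sub_nonneg.1 (nonneg_of_deriv_nonneg_of_zero
    (f := fun x => x - x ^ 3 / 6 + x ^ 5 / 120 - Real.sin x)
    (f' := fun x => 1 - x ^ 2 / 2 + x ^ 4 / 24 - Real.cos x)
    (fun x => ((((hasDerivAt_id x).sub (((hasDerivAt_id x).pow 3).div_const 6)).add
        (((hasDerivAt_id x).pow 5).div_const 120)).sub (Real.hasDerivAt_sin x)).congr_deriv
        (by simp; ring))
    (by simp) (fun x hx => by linarith [cos_le_taylor_four hx]) hx)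

theorem taylor_six_le_cos {x : ℝ} (hx : 0 ≤ x) :
    1 - x ^ 2 / 2 + x ^ 4 / 24 - x ^ 6 / 720 ≤ Real.cos x := by
  exact sub_nonneg.1 (nonneg_of_deriv_nonneg_of_zero
    (f := fun x => Real.cos x - (1 - x ^ 2 / 2 + x ^ 4 / 24 - x ^ 6 / 720))
    (f' := fun x => x - x ^ 3 / 6 + x ^ 5 / 120 - Real.sin x)
    (fun x => ((Real.hasDerivAt_cos x).sub ((((((hasDerivAt_id x).pow 2).div_const 2).const_sub 1).add
        (((hasDerivAt_id x).pow 4).div_const 24)).sub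
        (((hasDerivAt_id x).pow 6).div_const 720))).congr_deriv (by simp; ring))
    (by simp) (fun x hx => by linarith [sin_le_taylor_five hx]) hx)

theorem taylor_seven_le_sin {x : ℝ} (hx : 0 ≤ x) :
    x - x ^ 3 / 6 + x ^ 5 / 120 - x ^ 7 / 5040 ≤ Real.sin x := by
  exact sub_nonneg.1 (nonneg_of_deriv_nonneg_of_zero
    (f := fun x => Real.sin x - (x - x ^ 3 / 6 + x ^ 5 / 120 - x ^ 7 / 5040))
    (f' := fun x => Real.cos x - (1 - x ^ 2 / 2 + x ^ 4 / 24 - x ^ 6 / 720))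
    (fun x => ((Real.hasDerivAt_sin x).sub ((((hasDerivAt_id x).sub
        (((hasDerivAt_id x).pow 3).div_const 6)).add
        (((hasDerivAt_id x).pow 5).div_const 120)).sub
        (((hasDerivAt_id x).pow 7).div_const 5040))).congr_deriv (by simp; ring))
    (by simp) (fun x hx => by linarith [taylor_six_le_cos hx]) hx)

theorem one_sub_sq_le_sin (w : ℝ) : 1 - (w - Real.pi / 2) ^ 2 / 2 ≤ Real.sin w := by
  rw [← Real.cos_sub_pi_div_two]
  exact Real.one_sub_sq_div_two_le_cos

theorem sin_ge_of_le_1973 {w : ℝ} (h0 : 0 ≤ w) (hw : w ≤ 1.973) : 0.443 * w ≤ Real.sin w := by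
  rcases le_total w 1 with h | h
  · have := Real.sin_ge_sub_cube h0
    nlinarith [mul_nonneg h0 (sub_nonneg.2 h), mul_nonneg h0 h0]
  · have := one_sub_sq_le_sin w
    have h1 := Real.pi_gt_d4
    have h2 := Real.pi_lt_d4
    nlinarith [mul_nonneg (sub_nonneg.2 h) (sub_nonneg.2 hw)]

theorem sin_ge_of_le_2300 {w : ℝ} (h0 : 0 ≤ w) (hw : w ≤ 2.3) : 0.3 * w ≤ Real.sin w := by
  rcases le_total w 1 with h | h
  · have := Real.sin_ge_sub_cube h0
    nlinarith [mul_nonneg h0 (sub_nonneg.2 h), mul_nonneg h0 h0]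
  · have := one_sub_sq_le_sin w
    have h1 := Real.pi_gt_d4
    have h2 := Real.pi_lt_d4
    nlinarith [mul_nonneg (sub_nonneg.2 h) (sub_nonneg.2 hw)]

/-! ### The value of the limit -/

/-- The angle `√(2π) (√3 - 1)` exceeds `π / 2` by about `0.26418`, so the cosine is minus the sine
of a small angle, for which the Taylor bounds are sharp enough. -/
theorem separation_limit_approx :
    |Real.sqrt (8 - 4 * Real.sqrt 3 *
        Real.cos (Real.sqrt (2 * Real.pi) * (1 - Real.sqrt 3))) - 3.131948| < 5 / 10 ^ 7 := by
  have p1 := Real.pi_gt_d20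
  have p2 := Real.pi_lt_d20
  have a1 : 1.7320508075 ≤ Real.sqrt 3 := Real.le_sqrt_of_sq_le (by norm_num)
  have a2 : Real.sqrt 3 ≤ 1.7320508076 := Real.sqrt_le_iff.2 (by norm_num)
  have b1 : 2.5066282746 ≤ Real.sqrt (2 * Real.pi) := Real.le_sqrt_of_sq_le (by norm_num; linarith)
  have b2 : Real.sqrt (2 * Real.pi) ≤ 2.5066282747 :=
    Real.sqrt_le_iff.2 ⟨by norm_num, by norm_num; linarith⟩
  set y := Real.sqrt (2 * Real.pi) * (Real.sqrt 3 - 1) - Real.pi / 2 with hy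
  have hcos : Real.cos (Real.sqrt (2 * Real.pi) * (1 - Real.sqrt 3)) = -Real.sin y := by
    rw [hy, Real.sin_sub_pi_div_two, ← Real.cos_neg]
    ring_nf
  have y1 : 0.264182923 ≤ y := by nlinarith
  have y2 : y ≤ 0.264182928 := by nlinarith
  have hpi2 : y ≤ Real.pi / 2 := by linarith
  have s1 : 0.261120625 ≤ Real.sin y := by
    refine le_trans ?_ (Real.sin_le_sin_of_le_of_le_pi_div_two (by linarith) hpi2 y1)
    refine le_trans ?_ (taylor_seven_le_sin (by norm_num))
    norm_num
  have s2 : Real.sin y ≤ 0.26112065 := by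
    refine (Real.sin_le_sin_of_le_of_le_pi_div_two (by linarith) (by linarith) y2).trans ?_
    refine (sin_le_taylor_five (by norm_num)).trans ?_
    norm_num
  rw [hcos]
  have l : 3.1319476 ≤ Real.sqrt (8 - 4 * Real.sqrt 3 * -Real.sin y) :=
    Real.le_sqrt_of_sq_le (by nlinarith)
  have r : Real.sqrt (8 - 4 * Real.sqrt 3 * -Real.sin y) ≤ 3.1319483 :=
    Real.sqrt_le_iff.2 ⟨by norm_num, by nlinarith⟩
  rw [abs_lt]
  constructor <;> linarith

/-! ### Lower bound for two points that are not consecutive -/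

/-- With `x` the polar part, `P` the product of radii and `w` the azimuthal half-gap of two points
whose indices differ by two, a quarter of their scaled squared distance is `x + P sin² w`. It is at
least `4 sin² w / x`, and `P ≥ 1.999` keeps `w` so small that this suffices. The constant `2.4523`
is slightly more than a quarter of the square of the limit in the separation. -/
theorem lower_bound_of_diff_two {x P w : ℝ} (hx0 : 0 < x) (hw0 : 0 < w)
    (h1 : 0.998 * w ^ 2 ≤ Real.pi * x) (h2 : Real.pi * x ≤ w ^ 2) (hP : 1.999 ≤ P)
    (h : x * (P + x) = 2 ^ 2) : 2.4523 ≤ x + P * Real.sin w ^ 2 := by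
  have hpi := Real.pi_gt_d4
  have hpi' := Real.pi_lt_d4
  have hx : x ≤ 1.2365 := by nlinarith
  have hw : w ≤ 1.973 := by nlinarith
  have hs := sin_ge_of_le_1973 hw0.le hw
  have hS : 0.443 ^ 2 * (Real.pi * x) ≤ Real.sin w ^ 2 := by
    have := pow_le_pow_left₀ (by positivity) hs 2
    nlinarith
  have hS1 := Real.sin_sq_le_one w
  have key : x * 2.4523 ≤ x * (x + P * Real.sin w ^ 2) := by
    have e : x * (x + P * Real.sin w ^ 2) = x ^ 2 * (1 - Real.sin w ^ 2) + 4 * Real.sin w ^ 2 := by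
      linear_combination Real.sin w ^ 2 * h
    rw [e]
    nlinarith [mul_nonneg (sq_nonneg x) (sub_nonneg.2 hS1)]
  exact le_of_mul_le_mul_left key hx0

theorem le_sin_two_mul {t : ℝ} (h1 : 0.55 ≤ t) (h2 : t ≤ 0.8416) :
    0.8175 ≤ Real.sin (2 * t) := by
  refine le_trans ?_ (Real.sin_ge_sub_cube (by linarith : 0 ≤ 2 * t))
  have q1 : t ^ 2 ≤ 1.3916 * t - 0.46288 := by
    have := mul_nonneg (sub_nonneg.2 h1) (sub_nonneg.2 h2)
    linarith
  have q2 : t ^ 3 ≤ t * (1.3916 * t - 0.46288) := by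
    rw [pow_succ' t 2]
    exact mul_le_mul_of_nonneg_left q1 (by linarith)
  linarith

/-- The same bound for an index difference of at least three; no lower bound for `P` is needed,
since `P = n² / x - x`. -/
theorem lower_bound_of_three_le {x P w n : ℝ} (hx0 : 0 < x) (hx : x ≤ 2.4523) (hw0 : 0 < w)
    (h1 : 0.998 * w ^ 2 ≤ Real.pi * x) (h2 : Real.pi * x ≤ w ^ 2) (hn : 3 ≤ n)
    (h : x * (P + x) = n ^ 2) : 2.4523 ≤ x + P * Real.sin w ^ 2 := by
  have hpi := Real.pi_gt_d4
  have hpi' := Real.pi_lt_d4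
  have hw : w ≤ 2.7785 := by nlinarith
  have hS1 := Real.sin_sq_le_one w
  have hn2 : 9 ≤ n ^ 2 := by nlinarith
  have e : x ^ 2 * (1 - Real.sin w ^ 2) + 9 * Real.sin w ^ 2 ≤ x * (x + P * Real.sin w ^ 2) := by
    have : x * (x + P * Real.sin w ^ 2) =
        x ^ 2 * (1 - Real.sin w ^ 2) + n ^ 2 * Real.sin w ^ 2 := by
      linear_combination Real.sin w ^ 2 * h
    rw [this]
    gcongr
  rcases le_total w 2.3 with hw' | hw'
  · have hs := sin_ge_of_le_2300 hw0.le hw'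
    have hS : 0.3 ^ 2 * (Real.pi * x) ≤ Real.sin w ^ 2 := by
      have := pow_le_pow_left₀ (by positivity) hs 2
      nlinarith
    have key : x * 2.4523 ≤ x * (x + P * Real.sin w ^ 2) := by
      nlinarith [mul_nonneg (sq_nonneg x) (sub_nonneg.2 hS1)]
    exact le_of_mul_le_mul_left key hx0
  -- Beyond `2.3` the reflected angle `t = π - w` is small.
  set t := Real.pi - w with ht
  have ht1 : 0.363 ≤ t := by linarith
  have ht2 : t ≤ 0.8416 := by linarith
  have hst : Real.sin w = Real.sin t := by rw [ht, Real.sin_pi_sub]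
  rcases le_total t 0.55 with ht' | ht'
  · have hsin : 0.949 * t ≤ Real.sin t := by
      have := Real.sin_ge_sub_cube (by linarith : 0 ≤ t)
      have ht3 : t ^ 2 ≤ 0.55 ^ 2 := pow_le_pow_left₀ (by linarith) ht' 2
      nlinarith [mul_nonneg (by linarith : 0 ≤ t) (sub_nonneg.2 ht3)]
    have hS : 0.9 * t ^ 2 ≤ Real.sin w ^ 2 := by
      rw [hst]
      have := pow_le_pow_left₀ (by positivity) hsin 2
      nlinarith
    have hPlow : 1.217 ≤ P := by
      by_contra hcon
      push Not at hcon
      nlinarith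
    have hxlow : 0.998 * (3.1415 - 2 * t + t ^ 2 / 3.1416) ≤ x := by
      have hw2 : w = Real.pi - t := by rw [ht]; ring
      have : Real.pi * (0.998 * (3.1415 - 2 * t + t ^ 2 / 3.1416)) ≤ Real.pi * x := by
        refine le_trans ?_ h1
        rw [hw2]
        have q1 : Real.pi * (t ^ 2 / 3.1416) ≤ t ^ 2 := by
          rw [← mul_div_assoc, div_le_iff₀ (by norm_num), mul_comm]
          exact mul_le_mul_of_nonneg_left hpi'.le (sq_nonneg t)
        have q2 : Real.pi * 3.1415 ≤ Real.pi * Real.pi :=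
          mul_le_mul_of_nonneg_left hpi.le Real.pi_pos.le
        calc _ = 0.998 * (Real.pi * 3.1415 - 2 * (Real.pi * t) + Real.pi * (t ^ 2 / 3.1416)) := by
              ring
          _ ≤ 0.998 * (Real.pi * Real.pi - 2 * (Real.pi * t) + t ^ 2) := by gcongr
          _ = _ := by ring
      exact le_of_mul_le_mul_left this Real.pi_pos
    have : 1.217 * (0.9 * t ^ 2) ≤ P * Real.sin w ^ 2 :=
      mul_le_mul hPlow hS (by positivity) (by linarith)
    nlinarith
  · -- Here the two terms are comparable, and the arithmetic-geometric mean inequality suffices.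
    have hsin2 := le_sin_two_mul ht' ht2
    have key : x * 2.4523 ≤ x * (x + P * Real.sin w ^ 2) := by
      refine le_trans ?_ e
      rw [hst]
      rw [Real.sin_two_mul] at hsin2
      have hc := Real.cos_sq' t
      rw [← hc]
      have h6 := mul_le_mul_of_nonneg_left hsin2 hx0.le
      have h7 := sq_nonneg (x * Real.cos t - 3 * Real.sin t)
      linarith
    exact le_of_mul_le_mul_left key hx0

/-! ### The profile of two consecutive points -/

/-- The squared distance of two consecutive points of the planar limit spiral, divided by `4π`, as
a function of the half-difference `w` of their azimuths. -/
noncomputable def consecutiveProfile (w : ℝ) : ℝ :=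
  (Real.sin w / w) ^ 2 + (w * Real.cos w) ^ 2 / Real.pi ^ 2

/-- Divided by `cos w`, this is `tan w ≥ w + w³ / 3`. -/
theorem sin_sub_mul_cos_ge {w : ℝ} (h0 : 0 ≤ w) (hw : w ≤ Real.pi / 2) :
    w ^ 3 / 3 * Real.cos w ≤ Real.sin w - w * Real.cos w := by
  have hd : ∀ x, HasDerivAt (fun x => Real.sin x - x * Real.cos x - x ^ 3 / 3 * Real.cos x)
      (x * (Real.sin x - x * Real.cos x) + x ^ 3 / 3 * Real.sin x) x := fun x =>
    (((Real.hasDerivAt_sin x).sub ((hasDerivAt_id x).mul (Real.hasDerivAt_cos x))).sub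
      ((((hasDerivAt_id x).pow 3).div_const 3).mul (Real.hasDerivAt_cos x))).congr_deriv
      (by simp; ring)
  have hmono : MonotoneOn (fun x => Real.sin x - x * Real.cos x - x ^ 3 / 3 * Real.cos x)
      (Set.Icc 0 (Real.pi / 2)) := by
    apply monotoneOn_of_deriv_nonneg (convex_Icc _ _)
      (fun x _ => (hd x).continuousAt.continuousWithinAt)
      (fun x _ => (hd x).differentiableAt.differentiableWithinAt)
    intro x hx
    rw [interior_Icc] at hx
    rw [(hd x).deriv]
    have hc : 0 < Real.cos x := Real.cos_pos_of_mem_Ioo ⟨by linarith [hx.1, Real.pi_pos], hx.2⟩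
    have hs : 0 ≤ Real.sin x :=
      Real.sin_nonneg_of_nonneg_of_le_pi hx.1.le (by linarith [hx.2, Real.pi_pos])
    have ht := Real.le_tan hx.1.le hx.2
    rw [Real.tan_eq_sin_div_cos, le_div_iff₀ hc] at ht
    have hx0 := hx.1.le
    have := mul_nonneg hx0 (sub_nonneg.2 ht)
    positivity
  have := hmono ⟨le_rfl, by positivity⟩ ⟨h0, hw⟩ h0
  simp at this
  linarith

/-- The decrease of `(sin w / w)²` outweighs the growth of `(w cos w / π)²`, because
`tan w (tan w - w) ≥ w⁴ / 3 ≥ w⁴ / π²`. Hence, among consecutive points, those with the largest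
polar gap are closest to each other. -/
theorem antitoneOn_consecutiveProfile :
    AntitoneOn consecutiveProfile (Set.Ioo 0 (Real.pi / 2)) := by
  have hd : ∀ x ∈ Set.Ioo 0 (Real.pi / 2), HasDerivAt consecutiveProfile
      (2 * (Real.sin x / x) * ((Real.cos x * x - Real.sin x) / x ^ 2) +
        2 * (x * Real.cos x) * (Real.cos x - x * Real.sin x) / Real.pi ^ 2) x := by
    intro x hx
    have hx0 : x ≠ 0 := hx.1.ne'
    exact (((Real.hasDerivAt_sin x).div (hasDerivAt_id x) hx0).pow 2 |>.add
      ((((hasDerivAt_id x).mul (Real.hasDerivAt_cos x)).pow 2).div_const (Real.pi ^ 2))).congr_deriv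
      (by simp [-mul_eq_mul_left_iff, -mul_eq_mul_right_iff]; ring)
  apply antitoneOn_of_deriv_nonpos (convex_Ioo _ _)
    (fun x hx => (hd x hx).continuousAt.continuousWithinAt)
    (fun x hx => (hd x (interior_subset hx)).differentiableAt.differentiableWithinAt)
  intro x hx
  rw [interior_Ioo] at hx
  rw [(hd x hx).deriv]
  have hx0 := hx.1
  have hc : 0 < Real.cos x := Real.cos_pos_of_mem_Ioo ⟨by linarith [hx.1, Real.pi_pos], hx.2⟩
  have hs : 0 < Real.sin x :=
    Real.sin_pos_of_pos_of_lt_pi hx.1 (by linarith [hx.2, Real.pi_pos])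
  have ht := Real.le_tan hx.1.le hx.2
  rw [Real.tan_eq_sin_div_cos, le_div_iff₀ hc] at ht
  have h3 := sin_sub_mul_cos_ge hx.1.le hx.2.le
  have hpi : 3 ≤ Real.pi ^ 2 := by nlinarith [Real.pi_gt_three]
  have hA : x ^ 4 * Real.cos x ^ 2 / 3 ≤ Real.sin x * (Real.sin x - x * Real.cos x) := by
    calc x ^ 4 * Real.cos x ^ 2 / 3 = x * Real.cos x * (x ^ 3 / 3 * Real.cos x) := by ring
      _ ≤ _ := mul_le_mul ht h3 (by positivity) hs.le
  have hB : x * Real.cos x * (Real.cos x - x * Real.sin x) / Real.pi ^ 2 ≤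
      x * Real.cos x ^ 2 / 3 := by
    calc _ ≤ x * Real.cos x ^ 2 / Real.pi ^ 2 := by
          refine div_le_div_of_nonneg_right ?_ (by positivity)
          nlinarith [mul_pos (mul_pos hx0 hc) (mul_pos hx0 hs)]
      _ ≤ _ := by gcongr
  have hC : x * Real.cos x ^ 2 / 3 ≤ Real.sin x * (Real.sin x - x * Real.cos x) / x ^ 3 := by
    rw [le_div_iff₀ (by positivity)]
    linarith
  have e : 2 * (Real.sin x / x) * ((Real.cos x * x - Real.sin x) / x ^ 2) =
      -2 * (Real.sin x * (Real.sin x - x * Real.cos x) / x ^ 3) := by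
    field_simp
    ring
  have e2 : 2 * (x * Real.cos x) * (Real.cos x - x * Real.sin x) / Real.pi ^ 2 =
      2 * (x * Real.cos x * (Real.cos x - x * Real.sin x) / Real.pi ^ 2) := by ring
  rw [e, e2]
  linarith

/-- The relation `x (P + x) = 1` holds for consecutive points and makes `x + P sin² √(π x)` a
function of `x` alone. -/
theorem pi_mul_consecutiveProfile {x P : ℝ} (hx : 0 < x) (h : x * (P + x) = 1) :
    Real.pi * consecutiveProfile (Real.sqrt (Real.pi * x)) =
      x + P * Real.sin (Real.sqrt (Real.pi * x)) ^ 2 := by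
  have hP : P = 1 / x - x := by field_simp; linarith
  have hpi := Real.pi_pos
  rw [consecutiveProfile, div_pow, mul_pow, Real.sq_sqrt (by positivity), Real.cos_sq', hP]
  field_simp
  ring

/-! ### The distance of two spiral points -/

/-- Half the difference of the polar angles of two spiral points. -/
noncomputable def polarHalfGap (N i j : ℕ) : ℝ := (spiralPolar N j - spiralPolar N i) / 2

/-- The scaled polar part `N sin² δ` of the squared distance of two spiral points with polar
half-gap `δ`. -/
noncomputable def polarPart (N i j : ℕ) : ℝ := N * Real.sin (polarHalfGap N i j) ^ 2

/-- The scaled product `N sin φ_i sin φ_j` of the radii of the parallels through two spiral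
points. -/
noncomputable def radiiProduct (N i j : ℕ) : ℝ :=
  N * (Real.sin (spiralPolar N i) * Real.sin (spiralPolar N j))

theorem mul_dist_spiralPoint_sq (N i j : ℕ) :
    N * dist (spiralPoint N i) (spiralPoint N j) ^ 2 =
      4 * (polarPart N i j + radiiProduct N i j *
        Real.sin (Real.sqrt (N * Real.pi) * polarHalfGap N i j) ^ 2) := by
  rw [dist_comm, spiralPoint_eq_spiralCurve, spiralPoint_eq_spiralCurve, dist_spiralCurve_sq,
    polarPart, radiiProduct, polarHalfGap]
  ring

theorem radiiProduct_nonneg (N i j : ℕ) : 0 ≤ radiiProduct N i j :=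
  mul_nonneg (Nat.cast_nonneg N) (mul_nonneg
    (Real.sin_nonneg_of_nonneg_of_le_pi (spiralPolar_mem N i).1 (spiralPolar_mem N i).2)
    (Real.sin_nonneg_of_nonneg_of_le_pi (spiralPolar_mem N j).1 (spiralPolar_mem N j).2))

theorem cast_pos_of_mem {N k : ℕ} (hk : k ∈ Finset.Icc 1 N) : (0 : ℝ) < N := by
  rw [Finset.mem_Icc] at hk
  exact_mod_cast (by omega : 0 < N)

theorem sin_spiralPolar_sq {N k : ℕ} (hk : k ∈ Finset.Icc 1 N) :
    (N : ℝ) ^ 2 * Real.sin (spiralPolar N k) ^ 2 = (2 * k - 1) * (2 * N - 2 * k + 1) := by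
  have hN := cast_pos_of_mem hk
  rw [Real.sin_sq, cos_spiralPolar hk, spiralHeight]
  field_simp
  ring

theorem radiiProduct_sq {N i j : ℕ} (hi : i ∈ Finset.Icc 1 N) (hj : j ∈ Finset.Icc 1 N) :
    (N : ℝ) ^ 2 * radiiProduct N i j ^ 2 =
      ((2 * i - 1) * (2 * N - 2 * i + 1)) * ((2 * j - 1) * (2 * N - 2 * j + 1)) := by
  rw [← sin_spiralPolar_sq hi, ← sin_spiralPolar_sq hj, radiiProduct]
  ring

theorem polarHalfGap_pos {N i j : ℕ} (hi : i ∈ Finset.Icc 1 N) (hj : j ∈ Finset.Icc 1 N)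
    (hij : i < j) : 0 < polarHalfGap N i j := by
  have hN := cast_pos_of_mem hi
  have h : spiralPolar N i < spiralPolar N j := by
    refine Real.arccos_lt_arccos (spiralHeight_mem hj).1.le ?_ (spiralHeight_mem hi).2.le
    unfold spiralHeight
    have : (i : ℝ) < j := by exact_mod_cast hij
    gcongr
  unfold polarHalfGap
  linarith

theorem polarHalfGap_le (N i j : ℕ) : polarHalfGap N i j ≤ Real.pi / 2 := by
  unfold polarHalfGap
  linarith [(spiralPolar_mem N j).2, (spiralPolar_mem N i).1]

theorem polarPart_pos {N i j : ℕ} (hi : i ∈ Finset.Icc 1 N) (hj : j ∈ Finset.Icc 1 N)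
    (hij : i < j) : 0 < polarPart N i j := by
  have hN := cast_pos_of_mem hi
  have := Real.sin_pos_of_pos_of_lt_pi (polarHalfGap_pos hi hj hij)
    (by linarith [polarHalfGap_le N i j, Real.pi_pos])
  unfold polarPart
  positivity

/-- Equal spacing of the heights ties the polar part of a distance to the product of radii. -/
theorem polarPart_mul_add {N i j : ℕ} (hi : i ∈ Finset.Icc 1 N) (hj : j ∈ Finset.Icc 1 N) :
    polarPart N i j * (radiiProduct N i j + polarPart N i j) = ((j : ℝ) - i) ^ 2 := by
  have hN := cast_pos_of_mem hi
  have h1 := sin_mul_sin_eq_sq_sub_sq (spiralPolar N j) (spiralPolar N i)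
  have h2 := Real.cos_sub_cos (spiralPolar N j) (spiralPolar N i)
  rw [cos_spiralPolar hi, cos_spiralPolar hj] at h2
  have h3 : N * (Real.sin ((spiralPolar N j + spiralPolar N i) / 2) *
      Real.sin (polarHalfGap N i j)) = (j : ℝ) - i := by
    have : spiralHeight N j - spiralHeight N i = -2 * ((j : ℝ) - i) / N := by
      unfold spiralHeight; field_simp; ring
    rw [this] at h2
    unfold polarHalfGap
    field_simp at h2
    linarith
  rw [← h3, polarPart, radiiProduct, mul_comm (Real.sin (spiralPolar N i)), h1, ← polarHalfGap]
  ring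

/-- For small polar gaps, the azimuthal half-gap `√(Nπ) δ` is close to `√(π N sin² δ)`. -/
theorem azimuth_bounds {N i j : ℕ} (hN : 1600 ≤ N) (hi : i ∈ Finset.Icc 1 N)
    (hj : j ∈ Finset.Icc 1 N) (hij : i < j) (hx : polarPart N i j ≤ 2.4523) :
    0.998 * (Real.sqrt (N * Real.pi) * polarHalfGap N i j) ^ 2 ≤ Real.pi * polarPart N i j ∧
      Real.pi * polarPart N i j ≤ (Real.sqrt (N * Real.pi) * polarHalfGap N i j) ^ 2 := by
  have hN0 : (1600 : ℝ) ≤ N := by exact_mod_cast hN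
  have hδ0 := polarHalfGap_pos hi hj hij
  have hδ1 := polarHalfGap_le N i j
  rw [polarPart] at hx ⊢
  set δ := polarHalfGap N i j
  have hpi := Real.pi_pos
  rw [mul_pow, Real.sq_sqrt (by positivity)]
  have hs : 0 < Real.sin δ := Real.sin_pos_of_pos_of_lt_pi hδ0 (by linarith)
  constructor
  · have hδ2 : δ ≤ 1.6 * Real.sin δ := by
      calc δ = Real.pi / 2 * (2 / Real.pi * δ) := by field_simp
        _ ≤ 1.6 * Real.sin δ := by
          gcongr
          · linarith [Real.pi_lt_d2]
          · exact Real.mul_le_sin hδ0.le hδ1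
    have hs2 : Real.sin δ ^ 2 ≤ 2.4523 / 1600 := by nlinarith [sq_nonneg (Real.sin δ)]
    have hd2 : δ ^ 2 ≤ 0.004 := by
      have := pow_le_pow_left₀ hδ0.le hδ2 2
      linarith
    have hd : δ * (1 - δ ^ 2 / 6) ≤ Real.sin δ := by
      have := Real.sin_ge_sub_cube hδ0.le
      linarith
    have hsq : 0.998 * δ ^ 2 ≤ Real.sin δ ^ 2 := by
      have h1 : δ * 0.999 ≤ Real.sin δ :=
        le_trans (mul_le_mul_of_nonneg_left (by linarith) hδ0.le) hd
      have := pow_le_pow_left₀ (by positivity) h1 2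
      nlinarith
    calc 0.998 * (N * Real.pi * δ ^ 2) = N * Real.pi * (0.998 * δ ^ 2) := by ring
      _ ≤ N * Real.pi * Real.sin δ ^ 2 := by gcongr
      _ = _ := by ring
  · calc Real.pi * (N * Real.sin δ ^ 2) = N * Real.pi * Real.sin δ ^ 2 := by ring
      _ ≤ N * Real.pi * δ ^ 2 :=
        mul_le_mul_of_nonneg_left Real.sin_sq_le_sq (by positivity)

/-- The smallest parallels carrying spiral points are the first and the last one. -/
theorem sq_radius_ge {N k : ℕ} (hk : k ∈ Finset.Icc 1 N) :
    (2 * (N : ℝ) - 1) ≤ (2 * k - 1) * (2 * N - 2 * k + 1) := by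
  rw [Finset.mem_Icc] at hk
  have h1 : (1 : ℝ) ≤ k := by exact_mod_cast hk.1
  have h2 : (k : ℝ) ≤ N := by exact_mod_cast hk.2
  nlinarith [mul_nonneg (sub_nonneg.2 h1) (sub_nonneg.2 h2)]

theorem radiiProduct_ge {N i j : ℕ} (hN : 1600 ≤ N) (hi : i ∈ Finset.Icc 1 N)
    (hj : j ∈ Finset.Icc 1 N) : 1.999 ≤ radiiProduct N i j := by
  have hN0 : (1600 : ℝ) ≤ N := by exact_mod_cast hN
  have h := radiiProduct_sq hi hj
  have h1 := mul_le_mul (sq_radius_ge hi) (sq_radius_ge hj) (by linarith)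
    (by linarith [sq_radius_ge hi])
  rw [← h, ← sq, ← mul_pow] at h1
  have h2 := le_of_sq_le_sq h1 (mul_nonneg (by linarith) (radiiProduct_nonneg N i j))
  by_contra hcon
  push Not at hcon
  nlinarith

theorem lower_bound_of_not_consecutive {N i j : ℕ} (hN : 1600 ≤ N) (hi : i ∈ Finset.Icc 1 N)
    (hj : j ∈ Finset.Icc 1 N) (hij : i + 2 ≤ j) :
    4 * 2.4523 ≤ N * dist (spiralPoint N i) (spiralPoint N j) ^ 2 := by
  have hij' : i < j := by omega
  have hN0 : (1600 : ℝ) ≤ N := by exact_mod_cast hN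
  rw [mul_dist_spiralPoint_sq]
  gcongr
  have hx0 := polarPart_pos hi hj hij'
  have hP := radiiProduct_ge hN hi hj
  have hprod := polarPart_mul_add hi hj
  rcases le_total 2.4523 (polarPart N i j) with hx | hx
  · have := mul_nonneg (radiiProduct_nonneg N i j)
      (sq_nonneg (Real.sin (Real.sqrt (N * Real.pi) * polarHalfGap N i j)))
    linarith
  obtain ⟨h1, h2⟩ := azimuth_bounds hN hi hj hij' hx
  have hw0 : 0 < Real.sqrt (N * Real.pi) * polarHalfGap N i j :=
    mul_pos (Real.sqrt_pos.2 (mul_pos (by linarith) Real.pi_pos)) (polarHalfGap_pos hi hj hij')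
  rcases hij.eq_or_lt with h | h
  · refine lower_bound_of_diff_two hx0 hw0 h1 h2 hP ?_
    rw [hprod, ← h]
    push_cast
    ring
  · refine lower_bound_of_three_le hx0 hx hw0 h1 h2 ?_ hprod
    have : (i : ℝ) + 3 ≤ j := by exact_mod_cast h
    linarith

/-- The product of the radii of consecutive parallels is smallest at the pole: one of the two
indices lies in `[2, N - 1]`, where `N² sin² φ_k ≥ 3 (2N - 3)`. -/
theorem radiiProduct_one_two_le {N i : ℕ} (hN : 1600 ≤ N) (hi : i ∈ Finset.Icc 1 N)
    (hi' : i + 1 ∈ Finset.Icc 1 N) : radiiProduct N 1 2 ≤ radiiProduct N i (i + 1) := by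
  rcases (Finset.mem_Icc.1 hi).1.eq_or_lt with h | h
  · rw [← h]
  have hN0 : (1600 : ℝ) ≤ N := by exact_mod_cast hN
  have m1 : 1 ∈ Finset.Icc 1 N := Finset.mem_Icc.2 ⟨le_rfl, by omega⟩
  have m2 : 2 ∈ Finset.Icc 1 N := Finset.mem_Icc.2 ⟨by omega, by omega⟩
  have h2 : (2 : ℝ) ≤ i := by exact_mod_cast h
  have h3 : (i : ℝ) + 1 ≤ N := by exact_mod_cast (Finset.mem_Icc.1 hi').2
  have e1 := sq_radius_ge hi'
  have e2 : 3 * (2 * (N : ℝ) - 3) ≤ (2 * i - 1) * (2 * N - 2 * i + 1) := by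
    nlinarith [mul_nonneg (sub_nonneg.2 h2) (sub_nonneg.2 h3)]
  have hle : ((N : ℝ) * radiiProduct N 1 2) ^ 2 ≤ (N * radiiProduct N i (i + 1)) ^ 2 := by
    rw [mul_pow, mul_pow, radiiProduct_sq m1 m2, radiiProduct_sq hi hi']
    refine le_trans (le_of_eq ?_) (mul_le_mul e2 e1 (by linarith) (by linarith))
    push_cast
    ring
  have := le_of_sq_le_sq hle (mul_nonneg (by linarith) (radiiProduct_nonneg _ _ _))
  exact le_of_mul_le_mul_left this (by linarith)

/-- Consecutive points have the largest polar gap at the pole, and there the azimuthal half-gap is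
below `π / 2`, where replacing it by the smaller `√(π x)` decreases the distance. -/
theorem lower_bound_of_consecutive {N i : ℕ} (hN : 1600 ≤ N) (hi : i ∈ Finset.Icc 1 N)
    (hi' : i + 1 ∈ Finset.Icc 1 N) :
    4 * (Real.pi * consecutiveProfile (Real.sqrt (Real.pi * polarPart N 1 2))) ≤
      N * dist (spiralPoint N i) (spiralPoint N (i + 1)) ^ 2 := by
  have hN0 : (1600 : ℝ) ≤ N := by exact_mod_cast hN
  have m1 : 1 ∈ Finset.Icc 1 N := Finset.mem_Icc.2 ⟨le_rfl, by omega⟩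
  have m2 : 2 ∈ Finset.Icc 1 N := Finset.mem_Icc.2 ⟨by omega, by omega⟩
  have hX0 := polarPart_pos m1 m2 (by omega)
  have hx0 := polarPart_pos hi hi' (by omega)
  have hX : polarPart N 1 2 * (radiiProduct N 1 2 + polarPart N 1 2) = 1 := by
    rw [polarPart_mul_add m1 m2]; norm_num
  have hx : polarPart N i (i + 1) * (radiiProduct N i (i + 1) + polarPart N i (i + 1)) = 1 := by
    rw [polarPart_mul_add hi hi']; push_cast; ring
  have hPP := radiiProduct_one_two_le hN hi hi'
  have hP : 3.2 ≤ radiiProduct N 1 2 := by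
    have h := radiiProduct_sq m1 m2
    have h0 := radiiProduct_nonneg N 1 2
    by_contra hcon
    push Not at hcon
    have : radiiProduct N 1 2 ^ 2 ≤ 3.2 ^ 2 := pow_le_pow_left₀ h0 hcon.le 2
    push_cast at h
    nlinarith
  have hxX : polarPart N i (i + 1) ≤ polarPart N 1 2 := by
    by_contra hcon
    push Not at hcon
    have : polarPart N 1 2 * (radiiProduct N 1 2 + polarPart N 1 2) <
        polarPart N i (i + 1) * (radiiProduct N i (i + 1) + polarPart N i (i + 1)) :=
      mul_lt_mul'' hcon (by linarith) hX0.le (by linarith)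
    linarith
  have hXle : polarPart N 1 2 ≤ 0.3 := by nlinarith
  have hpi := Real.pi_gt_d2
  have hpi' := Real.pi_lt_d2
  obtain ⟨h1, h2⟩ := azimuth_bounds hN hi hi' (by omega) (by linarith)
  set w := Real.sqrt (N * Real.pi) * polarHalfGap N i (i + 1)
  have hw0 : 0 < w :=
    mul_pos (Real.sqrt_pos.2 (mul_pos (by linarith) Real.pi_pos))
      (polarHalfGap_pos hi hi' (by omega))
  have hw : w ≤ Real.pi / 2 := by
    have : w ≤ 1.5 := by nlinarith
    linarith
  have hmem : ∀ x, 0 < x → x ≤ 0.3 → Real.sqrt (Real.pi * x) ∈ Set.Ioo 0 (Real.pi / 2) := by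
    intro x hx hx'
    refine ⟨Real.sqrt_pos.2 (by positivity), ?_⟩
    rw [Real.sqrt_lt' (by positivity)]
    nlinarith
  have hanti := antitoneOn_consecutiveProfile (hmem _ hx0 (hxX.trans hXle)) (hmem _ hX0 hXle)
    (Real.sqrt_le_sqrt (mul_le_mul_of_nonneg_left hxX Real.pi_pos.le))
  calc _ ≤ 4 * (Real.pi * consecutiveProfile (Real.sqrt (Real.pi * polarPart N i (i + 1)))) := by
        gcongr
    _ ≤ _ := by
        rw [pi_mul_consecutiveProfile hx0 hx, mul_dist_spiralPoint_sq]
        have hwx : Real.sqrt (Real.pi * polarPart N i (i + 1)) ≤ w := Real.sqrt_le_iff.2 ⟨hw0.le, h2⟩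
        have hsn : Real.sin (Real.sqrt (Real.pi * polarPart N i (i + 1))) ≤ Real.sin w :=
          Real.sin_le_sin_of_le_of_le_pi_div_two
            (by linarith [Real.sqrt_nonneg (Real.pi * polarPart N i (i + 1))]) hw hwx
        have hsn0 : 0 ≤ Real.sin (Real.sqrt (Real.pi * polarPart N i (i + 1))) :=
          Real.sin_nonneg_of_nonneg_of_le_pi (Real.sqrt_nonneg _) (by linarith)
        have hP0 := radiiProduct_nonneg N i (i + 1)
        gcongr

/-! ### Limits for the first two points -/

theorem tendsto_radiiProduct_one_two :
    Tendsto (fun N : ℕ => radiiProduct N 1 2) atTop (𝓝 (2 * Real.sqrt 3)) := by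
  have hlim : Tendsto (fun N : ℕ => Real.sqrt (12 - 24 * (N : ℝ)⁻¹ + 9 * (N : ℝ)⁻¹ ^ 2)) atTop
      (𝓝 (Real.sqrt (12 - 24 * 0 + 9 * 0 ^ 2))) := by
    have h := tendsto_inv_atTop_nhds_zero_nat (𝕜 := ℝ)
    exact (((h.const_mul 24).const_sub 12).add ((h.pow 2).const_mul 9)).sqrt
  have e : Real.sqrt (12 - 24 * 0 + 9 * 0 ^ 2) = 2 * Real.sqrt 3 := by
    rw [show (12 - 24 * 0 + 9 * 0 ^ 2 : ℝ) = 2 ^ 2 * 3 by norm_num,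
      Real.sqrt_mul (by norm_num), Real.sqrt_sq (by norm_num)]
  rw [← e]
  refine hlim.congr' ?_
  filter_upwards [eventually_ge_atTop 2] with N hN
  have m1 : 1 ∈ Finset.Icc 1 N := Finset.mem_Icc.2 ⟨le_rfl, by omega⟩
  have m2 : 2 ∈ Finset.Icc 1 N := Finset.mem_Icc.2 ⟨by omega, by omega⟩
  have hN0 := cast_pos_of_mem m1
  have h : 12 - 24 * (N : ℝ)⁻¹ + 9 * (N : ℝ)⁻¹ ^ 2 = radiiProduct N 1 2 ^ 2 := by
    have := radiiProduct_sq m1 m2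
    push_cast at this
    field_simp
    linarith
  rw [h, Real.sqrt_sq (radiiProduct_nonneg N 1 2)]

theorem tendsto_polarPart_one_two :
    Tendsto (fun N : ℕ => polarPart N 1 2) atTop (𝓝 (2 - Real.sqrt 3)) := by
  have hlim : Tendsto (fun N : ℕ => (Real.sqrt (radiiProduct N 1 2 ^ 2 + 4) - radiiProduct N 1 2) / 2)
      atTop (𝓝 ((Real.sqrt ((2 * Real.sqrt 3) ^ 2 + 4) - 2 * Real.sqrt 3) / 2)) := by
    have h := tendsto_radiiProduct_one_two
    exact ((((h.pow 2).add_const 4).sqrt).sub h).div_const 2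
  have e : (Real.sqrt ((2 * Real.sqrt 3) ^ 2 + 4) - 2 * Real.sqrt 3) / 2 = 2 - Real.sqrt 3 := by
    rw [mul_pow, Real.sq_sqrt (by norm_num), show (2 ^ 2 * 3 + 4 : ℝ) = 4 ^ 2 by norm_num,
      Real.sqrt_sq (by norm_num)]
    ring
  rw [← e]
  refine hlim.congr' ?_
  filter_upwards [eventually_ge_atTop 2] with N hN
  have m1 : 1 ∈ Finset.Icc 1 N := Finset.mem_Icc.2 ⟨le_rfl, by omega⟩
  have m2 : 2 ∈ Finset.Icc 1 N := Finset.mem_Icc.2 ⟨by omega, by omega⟩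
  have hX0 := polarPart_pos m1 m2 (by omega)
  have hP0 := radiiProduct_nonneg N 1 2
  have hX : polarPart N 1 2 * (radiiProduct N 1 2 + polarPart N 1 2) = 1 := by
    rw [polarPart_mul_add m1 m2]; norm_num
  have : radiiProduct N 1 2 ^ 2 + 4 = (radiiProduct N 1 2 + 2 * polarPart N 1 2) ^ 2 := by
    linear_combination -4 * hX
  rw [this, Real.sqrt_sq (by linarith)]
  ring

theorem tendsto_polarHalfGap_one_two :
    Tendsto (fun N : ℕ => polarHalfGap N 1 2) atTop (𝓝 0) := by
  have hs : Tendsto (fun N : ℕ => Real.arcsin (Real.sqrt (polarPart N 1 2 * (N : ℝ)⁻¹))) atTop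
      (𝓝 (Real.arcsin (Real.sqrt ((2 - Real.sqrt 3) * 0)))) :=
    (Real.continuous_arcsin.tendsto _).comp
      ((tendsto_polarPart_one_two.mul (tendsto_inv_atTop_nhds_zero_nat (𝕜 := ℝ))).sqrt)
  rw [mul_zero, Real.sqrt_zero, Real.arcsin_zero] at hs
  refine hs.congr' ?_
  filter_upwards [eventually_ge_atTop 2] with N hN
  have m1 : 1 ∈ Finset.Icc 1 N := Finset.mem_Icc.2 ⟨le_rfl, by omega⟩
  have m2 : 2 ∈ Finset.Icc 1 N := Finset.mem_Icc.2 ⟨by omega, by omega⟩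
  have hN0 := cast_pos_of_mem m1
  have h0 := polarHalfGap_pos m1 m2 (by omega)
  have h1 := polarHalfGap_le N 1 2
  have : polarPart N 1 2 * (N : ℝ)⁻¹ = Real.sin (polarHalfGap N 1 2) ^ 2 := by
    unfold polarPart; field_simp
  rw [this, Real.sqrt_sq (Real.sin_nonneg_of_nonneg_of_le_pi h0.le (by linarith [Real.pi_pos])),
    Real.arcsin_sin (by linarith [Real.pi_pos]) h1]

theorem tendsto_azimuth_one_two :
    Tendsto (fun N : ℕ => Real.sqrt (N * Real.pi) * polarHalfGap N 1 2) atTop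
      (𝓝 (Real.sqrt (Real.pi * (2 - Real.sqrt 3)))) := by
  have hsinc : Tendsto (fun N : ℕ => Real.sinc (polarHalfGap N 1 2)) atTop (𝓝 1) := by
    have := (Real.continuous_sinc.tendsto 0).comp tendsto_polarHalfGap_one_two
    rwa [Real.sinc_zero] at this
  have hlim := ((tendsto_polarPart_one_two.const_mul Real.pi).sqrt).div hsinc one_ne_zero
  rw [div_one] at hlim
  refine hlim.congr' ?_
  filter_upwards [eventually_ge_atTop 2] with N hN
  have m1 : 1 ∈ Finset.Icc 1 N := Finset.mem_Icc.2 ⟨le_rfl, by omega⟩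
  have m2 : 2 ∈ Finset.Icc 1 N := Finset.mem_Icc.2 ⟨by omega, by omega⟩
  have hN0 := cast_pos_of_mem m1
  have h0 := polarHalfGap_pos m1 m2 (by omega)
  have h1 := polarHalfGap_le N 1 2
  have hs := Real.sin_pos_of_pos_of_lt_pi h0 (by linarith [Real.pi_pos])
  simp only [Pi.div_apply]
  rw [Real.sinc_of_ne_zero h0.ne', polarPart, ← mul_assoc, mul_comm Real.pi,
    Real.sqrt_mul (by positivity), Real.sqrt_sq hs.le]
  field_simp

/-- The half-angle formula, with `2 √(π (2 - √3)) = √(2π) (√3 - 1)`. -/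
theorem separation_limit_identity :
    4 * ((2 - Real.sqrt 3) + 2 * Real.sqrt 3 *
      Real.sin (Real.sqrt (Real.pi * (2 - Real.sqrt 3))) ^ 2) =
    8 - 4 * Real.sqrt 3 * Real.cos (Real.sqrt (2 * Real.pi) * (1 - Real.sqrt 3)) := by
  have h3 : Real.sqrt 3 ^ 2 = 3 := Real.sq_sqrt (by norm_num)
  have h1 : 1 ≤ Real.sqrt 3 := Real.le_sqrt_of_sq_le (by norm_num)
  have e : 2 * Real.sqrt (Real.pi * (2 - Real.sqrt 3)) =
      Real.sqrt (2 * Real.pi) * (Real.sqrt 3 - 1) := by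
    have e1 : (2 * Real.pi) * (Real.sqrt 3 - 1) ^ 2 = 2 ^ 2 * (Real.pi * (2 - Real.sqrt 3)) := by
      linear_combination 2 * Real.pi * h3
    have e2 := congrArg Real.sqrt e1
    rw [Real.sqrt_mul (by positivity), Real.sqrt_sq (sub_nonneg.2 h1),
      Real.sqrt_mul (by norm_num : (0 : ℝ) ≤ 2 ^ 2), Real.sqrt_sq (by norm_num)] at e2
    exact e2.symm
  rw [Real.sin_sq_eq_half_sub, e, ← Real.cos_neg (Real.sqrt (2 * Real.pi) * (1 - Real.sqrt 3))]
  ring_nf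

theorem tendsto_mul_dist_one_two_sq :
    Tendsto (fun N : ℕ => N * dist (spiralPoint N 1) (spiralPoint N 2) ^ 2) atTop
      (𝓝 (8 - 4 * Real.sqrt 3 * Real.cos (Real.sqrt (2 * Real.pi) * (1 - Real.sqrt 3)))) := by
  simp only [mul_dist_spiralPoint_sq, ← separation_limit_identity]
  exact (tendsto_polarPart_one_two.add (tendsto_radiiProduct_one_two.mul
    (((Real.continuous_sin.tendsto _).comp tendsto_azimuth_one_two).pow 2))).const_mul 4

theorem tendsto_consecutiveProfile :
    Tendsto (fun N : ℕ => 4 * (Real.pi *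
        consecutiveProfile (Real.sqrt (Real.pi * polarPart N 1 2)))) atTop
      (𝓝 (8 - 4 * Real.sqrt 3 * Real.cos (Real.sqrt (2 * Real.pi) * (1 - Real.sqrt 3)))) := by
  have h3 : Real.sqrt 3 ^ 2 = 3 := Real.sq_sqrt (by norm_num)
  have h2 : 0 < 2 - Real.sqrt 3 := sub_pos.2 (by rw [Real.sqrt_lt' (by norm_num)]; norm_num)
  rw [← separation_limit_identity,
    ← pi_mul_consecutiveProfile h2 (by linear_combination -h3 :
      (2 - Real.sqrt 3) * (2 * Real.sqrt 3 + (2 - Real.sqrt 3)) = 1)]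
  refine Tendsto.const_mul _ (Tendsto.const_mul _ ?_)
  have hw : Real.sqrt (Real.pi * (2 - Real.sqrt 3)) ≠ 0 :=
    (Real.sqrt_pos.2 (mul_pos Real.pi_pos h2)).ne'
  have hc : ContinuousAt consecutiveProfile (Real.sqrt (Real.pi * (2 - Real.sqrt 3))) := by
    unfold consecutiveProfile
    fun_prop (disch := assumption)
  exact hc.tendsto.comp ((tendsto_polarPart_one_two.const_mul Real.pi).sqrt)

/-! ### Separation -/

theorem separation_spiralConfig_le {N : ℕ} (hN : 2 ≤ N) :
    separation (spiralConfig N) ≤ dist (spiralPoint N 1) (spiralPoint N 2) := by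
  have m1 : 1 ∈ Finset.Icc 1 N := Finset.mem_Icc.2 ⟨le_rfl, by omega⟩
  have m2 : 2 ∈ Finset.Icc 1 N := Finset.mem_Icc.2 ⟨by omega, by omega⟩
  exact Set.infsep_le_dist_of_mem (spiralPoint_mem_spiralConfig m1)
    (spiralPoint_mem_spiralConfig m2) fun h => by
      have := injOn_spiralPoint N m1 m2 h
      omega

theorem le_sqrt_mul_separation {N : ℕ} (hN : 1600 ≤ N) :
    Real.sqrt (min (4 * (Real.pi * consecutiveProfile (Real.sqrt (Real.pi * polarPart N 1 2))))
      (4 * 2.4523)) ≤ Real.sqrt N * separation (spiralConfig N) := by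
  classical
  have hN0 : (0 : ℝ) < N := by exact_mod_cast (by omega : 0 < N)
  have hsN : 0 < Real.sqrt N := Real.sqrt_pos.2 hN0
  rw [← div_le_iff₀' hsN]
  have hnt : (spiralConfig N : Set S2).Nontrivial :=
    Finset.one_lt_card_iff_nontrivial.1 (by rw [card_spiralConfig]; omega)
  refine hnt.le_infsep ?_
  have key : ∀ i ∈ Finset.Icc 1 N, ∀ j ∈ Finset.Icc 1 N, i < j →
      Real.sqrt (min (4 * (Real.pi * consecutiveProfile
        (Real.sqrt (Real.pi * polarPart N 1 2)))) (4 * 2.4523)) / Real.sqrt N ≤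
      dist (spiralPoint N i) (spiralPoint N j) := by
    intro i hi j hj hij
    rw [div_le_iff₀' hsN]
    apply Real.sqrt_le_iff.2 ⟨by positivity, _⟩
    rw [mul_pow, Real.sq_sqrt hN0.le]
    rcases (Nat.succ_le_of_lt hij).eq_or_lt with h | h
    · subst h
      exact (min_le_left _ _).trans (lower_bound_of_consecutive hN hi hj)
    · exact (min_le_right _ _).trans (lower_bound_of_not_consecutive hN hi hj h)
  intro x hx y hy hxy
  rw [spiralConfig, Finset.mem_coe, Finset.mem_image] at hx hy
  obtain ⟨i, hi, rfl⟩ := hx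
  obtain ⟨j, hj, rfl⟩ := hy
  rcases lt_trichotomy i j with h | h | h
  · exact key i hi j hj h
  · exact absurd (by rw [h]) hxy
  · rw [dist_comm]
    exact key j hj i hi h

theorem tendsto_sqrt_mul_separation :
    Tendsto (fun N : ℕ => Real.sqrt N * separation (spiralConfig N)) atTop
      (𝓝 (Real.sqrt (8 - 4 * Real.sqrt 3 *
        Real.cos (Real.sqrt (2 * Real.pi) * (1 - Real.sqrt 3))))) := by
  set D := 8 - 4 * Real.sqrt 3 * Real.cos (Real.sqrt (2 * Real.pi) * (1 - Real.sqrt 3)) with hD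
  have hDle : D ≤ 4 * 2.4523 := by
    have h := (abs_lt.1 separation_limit_approx).2
    rw [← hD] at h
    have h2 : Real.sqrt D ≤ 3.1319485 := by linarith
    exact (Real.sqrt_le_iff.1 h2).2.trans (by norm_num)
  have hlow := (tendsto_consecutiveProfile.min
    (tendsto_const_nhds (x := (4 * 2.4523 : ℝ)))).sqrt
  rw [min_eq_left hDle] at hlow
  refine tendsto_of_tendsto_of_tendsto_of_le_of_le' hlow tendsto_mul_dist_one_two_sq.sqrt ?_ ?_
  · filter_upwards [eventually_ge_atTop 1600] with N hN
    exact le_sqrt_mul_separation hN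
  · filter_upwards [eventually_ge_atTop 2] with N hN
    rw [Real.sqrt_mul (Nat.cast_nonneg N), Real.sqrt_sq dist_nonneg]
    gcongr
    exact separation_spiralConfig_le hN

/-! ### Quasi-uniformity -/

/-- Since `√N δ(ω_N)` tends to a limit above `3`, the mesh ratio is at most `8 / 3` for all but
finitely many `N`. -/
theorem isQuasiUniform_spiralConfig : IsQuasiUniform spiralConfig := by
  have hlim : (3 : ℝ) < Real.sqrt (8 - 4 * Real.sqrt 3 *
      Real.cos (Real.sqrt (2 * Real.pi) * (1 - Real.sqrt 3))) := by
    linarith [(abs_lt.1 separation_limit_approx).1]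
  obtain ⟨N₀, hN₀⟩ := eventually_atTop.1 (tendsto_sqrt_mul_separation.eventually (lt_mem_nhds hlim))
  refine ⟨8 / 3 + ∑ N ∈ Finset.range N₀, |meshRatio (spiralConfig N)|, fun N hN => ?_⟩
  rcases lt_or_ge N N₀ with h | h
  · have h1 := Finset.single_le_sum (f := fun N => |meshRatio (spiralConfig N)|)
      (fun i _ => abs_nonneg _) (Finset.mem_range.2 h)
    have h2 := le_abs_self (meshRatio (spiralConfig N))
    linarith
  · have h1 := hN₀ N h
    have h2 : 0 ≤ ∑ N ∈ Finset.range N₀, |meshRatio (spiralConfig N)| :=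
      Finset.sum_nonneg fun i _ => abs_nonneg _
    have hsN : 0 < Real.sqrt N := Real.sqrt_pos.2 (by exact_mod_cast (by omega : 0 < N))
    have hsep : 3 / Real.sqrt N < separation (spiralConfig N) := by
      rwa [div_lt_iff₀' hsN]
    have : meshRatio (spiralConfig N) ≤ 8 / 3 := by
      unfold meshRatio
      calc _ ≤ (8 / Real.sqrt N) / (3 / Real.sqrt N) :=
            div_le_div₀ (by positivity) (coveringRadius_spiralConfig_le hN) (by positivity) hsep.le
        _ = 8 / 3 := by field_simp
    linarith

/-! ### The surface measure in spherical coordinates -/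

theorem continuous_sphericalCoords : Continuous fun p : ℝ × ℝ => sphericalCoords p.1 p.2 := by
  refine Continuous.subtype_mk ?_ _
  refine (PiLp.continuous_toLp 2 _).comp (continuous_pi fun i => ?_)
  fin_cases i <;> simp <;> fun_prop

open Pointwise in
theorem mem_Ioo_smul_sphere_iff (s : Set S2) (x : EuclideanSpace ℝ (Fin 3)) :
    x ∈ Set.Ioo (0 : ℝ) 1 • ((↑) '' s : Set (EuclideanSpace ℝ (Fin 3))) ↔
      0 < ‖x‖ ∧ ‖x‖ < 1 ∧ ‖x‖⁻¹ • x ∈ ((↑) '' s : Set (EuclideanSpace ℝ (Fin 3))) := by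
  constructor
  · rintro ⟨r, hr, _, ⟨y, hy, rfl⟩, rfl⟩
    have hn : ‖r • (y : EuclideanSpace ℝ (Fin 3))‖ = r := by
      rw [norm_smul, norm_eq_of_mem_sphere, mul_one, Real.norm_of_nonneg hr.1.le]
    simp only [hn]
    refine ⟨hr.1, hr.2, y, hy, ?_⟩
    rw [smul_smul, inv_mul_cancel₀ hr.1.ne', one_smul]
  · rintro ⟨h0, h1, h⟩
    refine ⟨‖x‖, ⟨h0, h1⟩, _, h, ?_⟩
    simp only
    rw [smul_smul, mul_inv_cancel₀ h0.ne', one_smul]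

open Pointwise in
theorem measurableSet_Ioo_smul_sphere {s : Set S2} (hs : MeasurableSet s) :
    MeasurableSet (Set.Ioo (0 : ℝ) 1 • ((↑) '' s : Set (EuclideanSpace ℝ (Fin 3)))) := by
  have h1 : MeasurableSet ((↑) '' s : Set (EuclideanSpace ℝ (Fin 3))) :=
    (Metric.isClosed_sphere.measurableSet).subtype_image hs
  have : (Set.Ioo (0 : ℝ) 1 • ((↑) '' s : Set (EuclideanSpace ℝ (Fin 3)))) =
      {x | 0 < ‖x‖} ∩ ({x | ‖x‖ < 1} ∩ (fun x => ‖x‖⁻¹ • x) ⁻¹' ((↑) '' s)) := by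
    ext x
    exact mem_Ioo_smul_sphere_iff s x
  rw [this]
  refine (measurableSet_lt measurable_const measurable_norm).inter
    ((measurableSet_lt measurable_norm measurable_const).inter ?_)
  exact (measurable_norm.inv.smul measurable_id) h1

theorem lintegral_euclidean_three {F : EuclideanSpace ℝ (Fin 3) → ℝ≥0∞} (hF : Measurable F) :
    ∫⁻ x, F x = ∫⁻ z : ℝ, ∫⁻ p : ℝ × ℝ, F !₂[p.1, p.2, z] := by
  have e1 := (EuclideanSpace.volume_preserving_symm_measurableEquiv_toLp (Fin 3)).symm
  have e2 := (volume_preserving_piFinSuccAbove (fun _ : Fin 3 => ℝ) 2).symm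
  have e3 := ((MeasurePreserving.id (volume : Measure ℝ)).prod
    (volume_preserving_finTwoArrow ℝ).symm)
  have e := (e1.comp e2).comp e3
  rw [← e.lintegral_comp hF]
  refine (lintegral_prod _ (hF.comp e.measurable).aemeasurable).trans ?_
  refine lintegral_congr fun z => lintegral_congr fun p => congrArg F ?_
  ext i
  fin_cases i <;> rfl

/-- Integration over `ℝ³` in spherical coordinates: polar coordinates in the horizontal plane,
then polar coordinates in the half-plane of height and horizontal radius. -/
theorem lintegral_spherical {F : EuclideanSpace ℝ (Fin 3) → ℝ≥0∞} (hF : Measurable F) :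
    ∫⁻ x, F x = ∫⁻ r in Set.Ioi (0 : ℝ), ∫⁻ φ in Set.Ioo 0 Real.pi,
      ∫⁻ θ in Set.Ioo (-Real.pi) Real.pi,
        ENNReal.ofReal (r ^ 2) * (ENNReal.ofReal (Real.sin φ) *
          F (r • (sphericalCoords φ θ : EuclideanSpace ℝ (Fin 3)))) := by
  have hvec : Measurable fun q : (ℝ × ℝ) × ℝ =>
      F !₂[q.1.2 * Real.cos q.2, q.1.2 * Real.sin q.2, q.1.1] := by
    refine hF.comp (Continuous.measurable ?_)
    refine (PiLp.continuous_toLp 2 _).comp (continuous_pi fun i => ?_)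
    fin_cases i <;> simp <;> fun_prop
  set H : ℝ × ℝ → ℝ≥0∞ := fun q => (Set.Ioi 0).indicator (fun _ => 1) q.2 *
    (ENNReal.ofReal q.2 * ∫⁻ θ in Set.Ioo (-Real.pi) Real.pi,
      F !₂[q.2 * Real.cos θ, q.2 * Real.sin θ, q.1]) with hH
  have hinner : Measurable fun q : ℝ × ℝ => ∫⁻ θ in Set.Ioo (-Real.pi) Real.pi,
      F !₂[q.2 * Real.cos θ, q.2 * Real.sin θ, q.1] := hvec.lintegral_prod_right'
  have hHm : Measurable H :=
    ((measurable_const.indicator measurableSet_Ioi).comp measurable_snd).mul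
      ((ENNReal.measurable_ofReal.comp measurable_snd).mul hinner)
  have step1 : ∫⁻ x, F x = ∫⁻ q, H q := by
    rw [lintegral_euclidean_three hF, Measure.volume_eq_prod, lintegral_prod _ hHm.aemeasurable]
    refine lintegral_congr fun z => ?_
    have hz : Measurable fun p : ℝ × ℝ => F !₂[p.1 * Real.cos p.2, p.1 * Real.sin p.2, z] :=
      hvec.comp ((measurable_const.prodMk measurable_fst).prodMk measurable_snd)
    have hpol := lintegral_comp_polarCoord_symm (fun p : ℝ × ℝ => F !₂[p.1, p.2, z])
    rw [← Measure.volume_eq_prod, ← hpol]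
    simp only [polarCoord_target, polarCoord_symm_apply, smul_eq_mul]
    rw [Measure.volume_eq_prod, ← Measure.prod_restrict]
    refine (lintegral_prod _
      ((ENNReal.measurable_ofReal.comp measurable_fst).mul hz).aemeasurable).trans ?_
    rw [← lintegral_indicator measurableSet_Ioi]
    refine lintegral_congr fun ρ => ?_
    simp only [hH, Set.indicator]
    split_ifs
    · have hzρ : Measurable fun θ => F !₂[ρ * Real.cos θ, ρ * Real.sin θ, z] :=
        hz.comp (measurable_const.prodMk measurable_id)
      rw [one_mul]
      exact lintegral_const_mul (ENNReal.ofReal ρ) hzρ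
    · rw [zero_mul]
  rw [step1, ← lintegral_comp_polarCoord_symm]
  simp only [polarCoord_target, polarCoord_symm_apply, smul_eq_mul]
  have hm : Measurable fun p : ℝ × ℝ =>
      ENNReal.ofReal p.1 * H (p.1 * Real.cos p.2, p.1 * Real.sin p.2) := by
    refine (ENNReal.measurable_ofReal.comp measurable_fst).mul (hHm.comp ?_)
    exact Continuous.measurable (by fun_prop)
  rw [Measure.volume_eq_prod, ← Measure.prod_restrict, lintegral_prod _ hm.aemeasurable]
  refine setLIntegral_congr_fun measurableSet_Ioi fun r hr => ?_
  have hr : 0 < r := hr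
  -- The half-plane of positive horizontal radius corresponds to polar angles in `(0, π)`.
  have hsub : Set.Ioo (0 : ℝ) Real.pi ⊆ Set.Ioo (-Real.pi) Real.pi :=
    Set.Ioo_subset_Ioo_left (by linarith [Real.pi_pos])
  rw [← Set.inter_eq_left.2 hsub, ← setLIntegral_indicator measurableSet_Ioo]
  refine setLIntegral_congr_fun measurableSet_Ioo fun φ hφ' => ?_
  by_cases hφ : φ ∈ Set.Ioo 0 Real.pi
  swap
  · have h0 : φ ≤ 0 := by
      by_contra h
      exact hφ ⟨not_le.1 h, hφ'.2⟩
    have : r * Real.sin φ ≤ 0 := mul_nonpos_of_nonneg_of_nonpos hr.le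
      (Real.sin_nonpos_of_nonpos_of_neg_pi_le h0 hφ'.1.le)
    rw [Set.indicator_of_notMem hφ]
    simp [hH, Set.indicator, not_lt.2 this]
  rw [Set.indicator_of_mem hφ]
  have hs : 0 < Real.sin φ := Real.sin_pos_of_mem_Ioo hφ
  have hpos : 0 < r * Real.sin φ := mul_pos hr hs
  have hFm : Measurable fun θ => F (r • (sphericalCoords φ θ : EuclideanSpace ℝ (Fin 3))) :=
    hF.comp ((continuous_subtype_val.comp (continuous_sphericalCoords.comp
      (continuous_const.prodMk continuous_id))).const_smul r).measurable
  simp only [hH, Set.indicator, Set.mem_Ioi, hpos, if_true, one_mul]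
  rw [lintegral_const_mul _ (by fun_prop), lintegral_const_mul _ hFm,
    ENNReal.ofReal_mul hr.le, sq, ENNReal.ofReal_mul hr.le]
  have hvec' : ∀ θ, (!₂[r * Real.sin φ * Real.cos θ, r * Real.sin φ * Real.sin θ,
      r * Real.cos φ] : EuclideanSpace ℝ (Fin 3)) = r • (sphericalCoords φ θ).1 := by
    intro θ
    ext i
    fin_cases i <;> simp [sphericalCoords, mul_assoc]
  simp only [hvec']
  ring

theorem lintegral_sq_Ioo : ∫⁻ r in Set.Ioo (0 : ℝ) 1, ENNReal.ofReal (r ^ 2) = 3⁻¹ := by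
  rw [Measure.restrict_congr_set Ioo_ae_eq_Ioc,
    ← ofReal_integral_eq_lintegral_ofReal (intervalIntegral.intervalIntegrable_pow 2).1
      (Eventually.of_forall fun r => sq_nonneg r),
    ← intervalIntegral.integral_of_le zero_le_one, integral_pow]
  norm_num
  rw [ENNReal.ofReal_div_of_pos (by norm_num)]
  simp

/-- The measure `sin φ dφ dθ` on the rectangle of spherical angles. -/
noncomputable def angleMeasure : Measure (ℝ × ℝ) :=
  ((volume : Measure (ℝ × ℝ)).restrict (Set.Ioo 0 Real.pi ×ˢ Set.Ioo (-Real.pi) Real.pi)).withDensity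
    fun p => ENNReal.ofReal (Real.sin p.1)

open Pointwise in
/-- The surface measure of a set is three times the volume of the cone over it, which spherical
coordinates evaluate. -/
theorem toSphere_eq_map_angleMeasure :
    (volume : Measure (EuclideanSpace ℝ (Fin 3))).toSphere =
      angleMeasure.map fun p => sphericalCoords p.1 p.2 := by
  classical
  have hsc := continuous_sphericalCoords.measurable
  ext s hs
  rw [Measure.toSphere_apply' _ hs, Measure.map_apply hsc hs, angleMeasure,
    withDensity_apply _ (hsc hs), finrank_euclideanSpace_fin]
  have hA := measurableSet_Ioo_smul_sphere hs
  rw [← lintegral_indicator_one hA, lintegral_spherical (measurable_one.indicator hA)]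
  have hm : Measurable fun p : ℝ × ℝ => ENNReal.ofReal (Real.sin p.1) *
      s.indicator 1 (sphericalCoords p.1 p.2) :=
    (ENNReal.measurable_ofReal.comp (Real.measurable_sin.comp measurable_fst)).mul
      ((measurable_one.indicator hs).comp hsc)
  have hval : ∀ r ∈ Set.Ioi (0 : ℝ), ∀ φ θ,
      (Set.Ioo (0 : ℝ) 1 • ((↑) '' s : Set (EuclideanSpace ℝ (Fin 3)))).indicator
        (1 : EuclideanSpace ℝ (Fin 3) → ℝ≥0∞) (r • (sphericalCoords φ θ : EuclideanSpace ℝ (Fin 3))) =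
      (Set.Iio (1 : ℝ)).indicator 1 r * s.indicator 1 (sphericalCoords φ θ) := by
    intro r hr φ θ
    have hr : 0 < r := hr
    have hn : ‖r • (sphericalCoords φ θ : EuclideanSpace ℝ (Fin 3))‖ = r := by
      rw [norm_smul, norm_eq_of_mem_sphere, mul_one, Real.norm_of_nonneg hr.le]
    have hiff := mem_Ioo_smul_sphere_iff s (r • (sphericalCoords φ θ : EuclideanSpace ℝ (Fin 3)))
    rw [hn, smul_smul, inv_mul_cancel₀ hr.ne', one_smul, Subtype.val_injective.mem_set_image] at hiff
    rw [Set.indicator_apply, if_congr hiff rfl rfl]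
    by_cases h1 : r < 1 <;> by_cases h2 : sphericalCoords φ θ ∈ s <;> simp [h1, h2, hr]
  have hstep : ∀ r ∈ Set.Ioi (0 : ℝ), (∫⁻ φ in Set.Ioo 0 Real.pi,
      ∫⁻ θ in Set.Ioo (-Real.pi) Real.pi, ENNReal.ofReal (r ^ 2) * (ENNReal.ofReal (Real.sin φ) *
        (Set.Ioo (0 : ℝ) 1 • ((↑) '' s : Set (EuclideanSpace ℝ (Fin 3)))).indicator
        (1 : EuclideanSpace ℝ (Fin 3) → ℝ≥0∞) (r • (sphericalCoords φ θ : EuclideanSpace ℝ (Fin 3))))) =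
      (Set.Iio (1 : ℝ)).indicator (fun r => ENNReal.ofReal (r ^ 2)) r *
        ∫⁻ φ in Set.Ioo 0 Real.pi, ∫⁻ θ in Set.Ioo (-Real.pi) Real.pi,
          ENNReal.ofReal (Real.sin φ) * s.indicator 1 (sphericalCoords φ θ) := by
    intro r hr
    have hm₁ : Measurable fun φ => ∫⁻ θ in Set.Ioo (-Real.pi) Real.pi,
        ENNReal.ofReal (Real.sin φ) * s.indicator (1 : S2 → ℝ≥0∞) (sphericalCoords φ θ) :=
      hm.lintegral_prod_right'
    have hm₂ : ∀ φ, Measurable fun θ => ENNReal.ofReal (Real.sin φ) *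
        s.indicator (1 : S2 → ℝ≥0∞) (sphericalCoords φ θ) :=
      fun φ => measurable_const.mul ((measurable_one.indicator hs).comp
        (continuous_sphericalCoords.comp (continuous_const.prodMk continuous_id)).measurable)
    rw [← lintegral_const_mul _ hm₁]
    refine lintegral_congr fun φ => ?_
    rw [← lintegral_const_mul _ (hm₂ φ)]
    refine lintegral_congr fun θ => ?_
    rw [hval r hr φ θ]
    by_cases h1 : r < 1 <;> simp [Set.indicator, h1]
  rw [setLIntegral_congr_fun measurableSet_Ioi hstep,
    lintegral_mul_const _ (Measurable.indicator (by fun_prop) measurableSet_Iio),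
    setLIntegral_indicator measurableSet_Iio, Set.inter_comm, Set.Ioi_inter_Iio, lintegral_sq_Ioo,
    ← mul_assoc, Nat.cast_ofNat, ENNReal.mul_inv_cancel (by norm_num) (by norm_num), one_mul,
    ← lintegral_indicator (hsc hs), Measure.volume_eq_prod, ← Measure.prod_restrict]
  refine (lintegral_prod _ hm.aemeasurable).symm.trans (lintegral_congr fun p => ?_)
  by_cases h : sphericalCoords p.1 p.2 ∈ s <;> simp [Set.indicator, h]

theorem integral_toSphere_eq (f : C(S2, ℝ)) :
    ∫ x, f x ∂(volume : Measure (EuclideanSpace ℝ (Fin 3))).toSphere =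
      ∫ φ in (0 : ℝ)..Real.pi, ∫ θ in (-Real.pi)..Real.pi,
        f (sphericalCoords φ θ) * Real.sin φ := by
  have hpi := Real.pi_pos
  have hsc := continuous_sphericalCoords
  have hcont : Continuous fun p : ℝ × ℝ => f (sphericalCoords p.1 p.2) * Real.sin p.1 :=
    (f.continuous.comp hsc).mul (Real.continuous_sin.comp continuous_fst)
  have hint : IntegrableOn (fun p : ℝ × ℝ => f (sphericalCoords p.1 p.2) * Real.sin p.1)
      (Set.Ioo 0 Real.pi ×ˢ Set.Ioo (-Real.pi) Real.pi) :=
    (hcont.continuousOn.integrableOn_compact (isCompact_Icc.prod isCompact_Icc)).mono_set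
      (Set.prod_mono Set.Ioo_subset_Icc_self Set.Ioo_subset_Icc_self)
  have hdens : Measurable fun p : ℝ × ℝ => ENNReal.ofReal (Real.sin p.1) :=
    ENNReal.measurable_ofReal.comp (Real.measurable_sin.comp measurable_fst)
  rw [toSphere_eq_map_angleMeasure, integral_map hsc.measurable.aemeasurable
    f.continuous.aestronglyMeasurable, angleMeasure,
    integral_withDensity_eq_integral_toReal_smul hdens
      (Eventually.of_forall fun _ => ENNReal.ofReal_lt_top)]
  have hcongr : ∫ p in Set.Ioo 0 Real.pi ×ˢ Set.Ioo (-Real.pi) Real.pi,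
      (ENNReal.ofReal (Real.sin p.1)).toReal • f (sphericalCoords p.1 p.2) =
      ∫ p in Set.Ioo 0 Real.pi ×ˢ Set.Ioo (-Real.pi) Real.pi,
        f (sphericalCoords p.1 p.2) * Real.sin p.1 := by
    refine setIntegral_congr_fun (measurableSet_Ioo.prod measurableSet_Ioo) fun p hp => ?_
    simp only [smul_eq_mul]
    rw [ENNReal.toReal_ofReal (Real.sin_pos_of_mem_Ioo hp.1).le, mul_comm]
  rw [hcongr, Measure.volume_eq_prod, setIntegral_prod _ hint,
    intervalIntegral.integral_of_le hpi.le, ← integral_Ioc_eq_integral_Ioo]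
  refine integral_congr_ae (Eventually.of_forall fun φ => ?_)
  simp only
  rw [intervalIntegral.integral_of_le (by linarith), ← integral_Ioc_eq_integral_Ioo]

theorem integral_sphereSigma (f : C(S2, ℝ)) :
    ∫ x, f x ∂sphereSigma = (4 * Real.pi)⁻¹ * ∫ φ in (0 : ℝ)..Real.pi,
      ∫ θ in (-Real.pi)..Real.pi, f (sphericalCoords φ θ) * Real.sin φ := by
  have hone := integral_toSphere_eq (1 : C(S2, ℝ))
  simp only [ContinuousMap.one_apply, one_mul, integral_const, smul_eq_mul, mul_one,
    intervalIntegral.integral_const, sub_neg_eq_add, intervalIntegral.integral_const_mul,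
    integral_sin, Real.cos_zero, Real.cos_pi] at hone
  rw [sphereSigma, integral_smul_measure, integral_toSphere_eq, ENNReal.toReal_inv, smul_eq_mul]
  congr 2
  rw [← measureReal_def, hone]
  ring

/-! ### Averaging along a fast spiral -/

/-- If `G` varies slowly in its first variable and is `2π`-periodic in the second, then along a line
`θ = L t` of large slope `L` the second variable is averaged out. -/
theorem tendsto_integral_line {G : ℝ → ℝ → ℝ} (hG : Continuous (Function.uncurry G))
    {M : ℝ} (hM : ∀ t θ, |G t θ| ≤ M) (hper : ∀ t, Function.Periodic (G t) (2 * Real.pi))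
    (huc : ∀ ε > 0, ∃ η > 0, ∀ t t' θ, |t - t'| < η → |G t θ - G t' θ| ≤ ε) :
    Tendsto (fun L : ℝ => ∫ t in (0 : ℝ)..Real.pi, G t (L * t)) atTop
      (𝓝 ((2 * Real.pi)⁻¹ * ∫ t in (0 : ℝ)..Real.pi, ∫ θ in (-Real.pi)..Real.pi, G t θ)) := by
  have hpi := Real.pi_pos
  have hM0 : 0 ≤ M := (abs_nonneg _).trans (hM 0 0)
  have hcont : ∀ {u v : ℝ → ℝ}, Continuous u → Continuous v → Continuous fun t => G (u t) (v t) :=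
    fun hu hv => hG.comp (hu.prodMk hv)
  rw [Metric.tendsto_atTop]
  intro ε hε
  obtain ⟨η, hη, hGη⟩ := huc (ε / (4 * Real.pi)) (by positivity)
  refine ⟨max 1 (max (4 * Real.pi / η) (16 * Real.pi * (M + 1) / ε)), fun L hL => ?_⟩
  have hL1 : 1 ≤ L := (le_max_left _ _).trans hL
  have hL0 : 0 < L := by linarith
  have hL2 : 4 * Real.pi / η ≤ L := (le_max_left _ _).trans ((le_max_right _ _).trans hL)
  have hL3 : 16 * Real.pi * (M + 1) / ε ≤ L := (le_max_right _ _).trans ((le_max_right _ _).trans hL)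
  rw [div_le_iff₀ hη] at hL2
  rw [div_le_iff₀ hε] at hL3
  set I := ∫ t in (0 : ℝ)..Real.pi, G t (L * t) with hI
  -- Shifting the azimuth by `s` changes the integral little: translate `t` by `s / L`.
  have hshift : ∀ s ∈ Set.Icc (-Real.pi) Real.pi,
      |(∫ t in (0 : ℝ)..Real.pi, G t (L * t + s)) - I| ≤ ε / 2 := by
    intro s hs
    have hsabs : |s| ≤ Real.pi := abs_le.2 hs
    have hsL : |s / L| ≤ Real.pi / L := by
      rw [abs_div, abs_of_pos hL0]; gcongr
    have c1 : Continuous fun t => G t (L * t + s) := hcont (by fun_prop) (by fun_prop)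
    have c2 : Continuous fun t => G (t + s / L) (L * t + s) := hcont (by fun_prop) (by fun_prop)
    have c3 : Continuous fun t => G t (L * t) := hcont (by fun_prop) (by fun_prop)
    have h1 : |(∫ t in (0 : ℝ)..Real.pi, G t (L * t + s)) -
        ∫ t in (0 : ℝ)..Real.pi, G (t + s / L) (L * t + s)| ≤ ε / 4 := by
      rw [← intervalIntegral.integral_sub (c1.intervalIntegrable _ _) (c2.intervalIntegrable _ _)]
      have := intervalIntegral.norm_integral_le_of_norm_le_const (a := 0) (b := Real.pi)
        (f := fun t => G t (L * t + s) - G (t + s / L) (L * t + s)) (C := ε / (4 * Real.pi))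
        (fun t _ => by
          refine hGη _ _ _ ?_
          rw [sub_add_cancel_left, abs_neg]
          refine hsL.trans_lt ?_
          rw [div_lt_iff₀ hL0]
          nlinarith)
      rw [Real.norm_eq_abs, sub_zero, abs_of_pos hpi] at this
      refine this.trans_eq ?_
      field_simp
    have h2 : (∫ t in (0 : ℝ)..Real.pi, G (t + s / L) (L * t + s)) =
        ∫ t in (s / L)..(Real.pi + s / L), G t (L * t) := by
      have := intervalIntegral.integral_comp_add_right (a := 0) (b := Real.pi)
        (fun t => G t (L * t)) (s / L)
      rw [zero_add] at this
      rw [← this]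
      congr 1
      ext t
      congr 1
      field_simp
    have h3 : |(∫ t in (s / L)..(Real.pi + s / L), G t (L * t)) - I| ≤ ε / 4 := by
      have ii := fun a b => c3.intervalIntegrable (μ := volume) a b
      rw [hI, intervalIntegral.integral_interval_sub_interval_comm (ii _ _) (ii _ _) (ii _ _)]
      have b1 := intervalIntegral.norm_integral_le_of_norm_le_const (a := s / L) (b := 0)
        (f := fun t => G t (L * t)) (C := M) (fun t _ => hM _ _)
      have b2 := intervalIntegral.norm_integral_le_of_norm_le_const (a := Real.pi + s / L)
        (b := Real.pi) (f := fun t => G t (L * t)) (C := M) (fun t _ => hM _ _)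
      rw [Real.norm_eq_abs] at b1 b2
      have e1 : |0 - s / L| = |s / L| := by rw [zero_sub, abs_neg]
      have e2 : |Real.pi - (Real.pi + s / L)| = |s / L| := by rw [sub_add_cancel_left, abs_neg]
      rw [e1] at b1
      rw [e2] at b2
      have b3 : M * |s / L| ≤ ε / 16 := by
        calc M * |s / L| ≤ M * (Real.pi / L) := by gcongr
          _ = M * Real.pi / L := by ring
          _ ≤ ε / 16 := by rw [div_le_iff₀ hL0]; nlinarith
      refine (abs_sub _ _).trans ?_
      linarith
    rw [h2] at h1
    calc _ ≤ |(∫ t in (0 : ℝ)..Real.pi, G t (L * t + s)) -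
          ∫ t in (s / L)..(Real.pi + s / L), G t (L * t)| +
          |(∫ t in (s / L)..(Real.pi + s / L), G t (L * t)) - I| := abs_sub_le _ _ _
      _ ≤ ε / 2 := by linarith
  -- Averaging over all shifts replaces `G t (L t + s)` by its mean over a period.
  have hc2 : Continuous (Function.uncurry fun s t => G t (L * t + s)) :=
    hG.comp (continuous_snd.prodMk ((continuous_snd.const_mul L).add continuous_fst))
  have hJ : ∫ s in (-Real.pi)..Real.pi, ∫ t in (0 : ℝ)..Real.pi, G t (L * t + s) =
      ∫ t in (0 : ℝ)..Real.pi, ∫ θ in (-Real.pi)..Real.pi, G t θ := by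
    rw [intervalIntegral_intervalIntegral_swap]
    · refine intervalIntegral.integral_congr fun t _ => ?_
      rw [intervalIntegral.integral_comp_add_left (fun θ => G t θ) (L * t)]
      have := (hper t).intervalIntegral_add_eq (L * t + -Real.pi) (-Real.pi)
      rw [show L * t + -Real.pi + 2 * Real.pi = L * t + Real.pi by ring,
        show -Real.pi + 2 * Real.pi = Real.pi by ring] at this
      exact this
    · exact (hc2.continuousOn.integrableOn_compact (isCompact_uIcc.prod isCompact_uIcc)).mono_set
        (Set.prod_mono Set.uIoc_subset_uIcc Set.uIoc_subset_uIcc)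
  have hmean : |(∫ s in (-Real.pi)..Real.pi, ∫ t in (0 : ℝ)..Real.pi, G t (L * t + s)) -
      2 * Real.pi * I| ≤ ε / 2 * (2 * Real.pi) := by
    have hJc : Continuous fun s => ∫ t in (0 : ℝ)..Real.pi, G t (L * t + s) :=
      intervalIntegral.continuous_parametric_intervalIntegral_of_continuous' hc2 _ _
    have e : 2 * Real.pi * I = ∫ s in (-Real.pi)..Real.pi, I := by
      rw [intervalIntegral.integral_const, smul_eq_mul]; ring
    rw [e, ← intervalIntegral.integral_sub (hJc.intervalIntegrable _ _) (by simp)]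
    have := intervalIntegral.norm_integral_le_of_norm_le_const (a := -Real.pi) (b := Real.pi)
      (f := fun s => (∫ t in (0 : ℝ)..Real.pi, G t (L * t + s)) - I) (C := ε / 2)
      (fun s hs => by
        rw [Set.uIoc_of_le (by linarith)] at hs
        exact hshift s ⟨hs.1.le, hs.2⟩)
    rw [show Real.pi - -Real.pi = 2 * Real.pi by ring, abs_of_pos (by positivity)] at this
    exact this
  rw [hJ] at hmean
  rw [Real.dist_eq, abs_sub_comm]
  set J := ∫ t in (0 : ℝ)..Real.pi, ∫ θ in (-Real.pi)..Real.pi, G t θ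
  have e : (2 * Real.pi)⁻¹ * J - I = (2 * Real.pi)⁻¹ * (J - 2 * Real.pi * I) := by field_simp
  rw [e, abs_mul, abs_of_pos (by positivity : 0 < (2 * Real.pi)⁻¹)]
  calc _ ≤ (2 * Real.pi)⁻¹ * (ε / 2 * (2 * Real.pi)) := by gcongr
    _ = ε / 2 := by field_simp
    _ < ε := by linarith

theorem tendsto_integral_spiralCurve (f : C(S2, ℝ)) :
    Tendsto (fun N : ℕ => ∫ t in (0 : ℝ)..Real.pi, f (spiralCurve N t) * Real.sin t) atTop
      (𝓝 (2 * ∫ x, f x ∂sphereSigma)) := by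
  have hL : Tendsto (fun N : ℕ => Real.sqrt (N * Real.pi)) atTop atTop :=
    Real.tendsto_sqrt_atTop.comp
      ((tendsto_natCast_atTop_atTop (R := ℝ)).atTop_mul_const Real.pi_pos)
  have hcomp : ∀ x, |f x| ≤ ‖f‖ := fun x => f.norm_coe_le_norm x
  have key := tendsto_integral_line (G := fun t θ => f (sphericalCoords t θ) * Real.sin t)
    (M := ‖f‖) ((f.continuous.comp continuous_sphericalCoords).mul
      (Real.continuous_sin.comp continuous_fst))
    (fun t θ => by
      rw [abs_mul]
      calc _ ≤ ‖f‖ * 1 := mul_le_mul (hcomp _) (Real.abs_sin_le_one t) (abs_nonneg _) (norm_nonneg _)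
        _ = ‖f‖ := mul_one _)
    (fun t θ => by simp [sphericalCoords])
    (fun ε hε => by
      have huc := CompactSpace.uniformContinuous_of_continuous f.continuous
      obtain ⟨η, hη, h⟩ := Metric.uniformContinuous_iff.1 huc (ε / 2) (by positivity)
      refine ⟨min η (ε / (2 * (‖f‖ + 1))), lt_min hη (by positivity), fun t t' θ htt => ?_⟩
      have h1 : dist (sphericalCoords t θ) (sphericalCoords t' θ) ≤ |t - t'| := by
        refine le_of_sq_le_sq ?_ (abs_nonneg _)
        rw [dist_sphericalCoords_sq, sub_self, zero_div, Real.sin_zero, sq_abs]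
        have := Real.sin_sq_le_sq (x := (t - t') / 2)
        linarith
      have h2 := (h (h1.trans_lt (htt.trans_le (min_le_left _ _)))).le
      rw [Real.dist_eq] at h2
      have h3 : |t - t'| * (2 * (‖f‖ + 1)) ≤ ε :=
        (le_div_iff₀ (by positivity)).1 (htt.le.trans (min_le_right _ _))
      have e : f (sphericalCoords t θ) * Real.sin t - f (sphericalCoords t' θ) * Real.sin t' =
          (f (sphericalCoords t θ) - f (sphericalCoords t' θ)) * Real.sin t +
          f (sphericalCoords t' θ) * (Real.sin t - Real.sin t') := by ring
      rw [e]
      calc _ ≤ |f (sphericalCoords t θ) - f (sphericalCoords t' θ)| * |Real.sin t| +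
            |f (sphericalCoords t' θ)| * |Real.sin t - Real.sin t'| := by
            rw [← abs_mul, ← abs_mul]; exact abs_add_le _ _
        _ ≤ ε / 2 * 1 + ‖f‖ * |t - t'| := by
            refine add_le_add (mul_le_mul h2 (Real.abs_sin_le_one t) (abs_nonneg _) (by positivity))
              (mul_le_mul (hcomp _) (Real.abs_sin_sub_sin_le t t') (abs_nonneg _) (norm_nonneg _))
        _ ≤ ε := by nlinarith [abs_nonneg (t - t')])
  have hval : 2 * ∫ x, f x ∂sphereSigma = (2 * Real.pi)⁻¹ * ∫ t in (0 : ℝ)..Real.pi,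
      ∫ θ in (-Real.pi)..Real.pi, f (sphericalCoords t θ) * Real.sin t := by
    rw [integral_sphereSigma]
    have := Real.pi_pos.ne'
    field_simp
    ring
  rw [hval]
  exact key.comp hL

/-! ### Equidistribution -/

/-- The boundaries of the polar-angle intervals over which the height decreases by `2 / N`. -/
noncomputable def polarBoundary (N k : ℕ) : ℝ := Real.arccos (1 - 2 * k / N)

theorem integral_normalizedCounting_spiralConfig (N : ℕ) (f : C(S2, ℝ)) :
    ∫ x, f x ∂(normalizedCounting N (spiralConfig N)) =
      (N : ℝ)⁻¹ * ∑ k ∈ Finset.range N, f (spiralPoint N (k + 1)) := by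
  classical
  rw [normalizedCounting, integral_smul_measure,
    integral_finsetSum_measure (fun x _ => integrable_dirac (by simp))]
  simp only [integral_dirac, ENNReal.toReal_inv, ENNReal.toReal_natCast, smul_eq_mul]
  congr 1
  rw [spiralConfig, Finset.sum_image (injOn_spiralPoint N), Finset.range_eq_Ico,
    Finset.sum_Ico_add' (fun k => f (spiralPoint N k)) 0 N 1, zero_add]
  rfl

theorem polarBoundary_mono {N k : ℕ} : polarBoundary N k ≤ polarBoundary N (k + 1) := by
  refine Real.arccos_le_arccos ?_
  gcongr
  simp

theorem cos_polarBoundary {N k : ℕ} (hN : 1 ≤ N) (hk : k ≤ N) :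
    Real.cos (polarBoundary N k) = 1 - 2 * k / N := by
  have hN0 : (0 : ℝ) < N := by exact_mod_cast hN
  have hk' : (k : ℝ) ≤ N := by exact_mod_cast hk
  have h1 : 2 * (k : ℝ) / N ≤ 2 := by rw [div_le_iff₀ hN0]; linarith
  have h2 : 0 ≤ 2 * (k : ℝ) / N := by positivity
  exact Real.cos_arccos (by linarith) (by linarith)

theorem integral_sin_polarBoundary {N k : ℕ} (hk : k + 1 ≤ N) :
    ∫ t in (polarBoundary N k)..(polarBoundary N (k + 1)), Real.sin t = 2 / N := by
  have hN0 : (0 : ℝ) < N := by exact_mod_cast (by omega : 0 < N)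
  rw [integral_sin, cos_polarBoundary (by omega) (by omega), cos_polarBoundary (by omega) hk]
  push_cast
  field_simp
  ring

theorem continuous_spiralCurve (N : ℕ) : Continuous (spiralCurve N) :=
  Continuous.comp (f := fun t : ℝ => (t, Real.sqrt (N * Real.pi) * t))
    continuous_sphericalCoords (by fun_prop)

theorem dist_spiralPoint_spiralCurve_le {N k : ℕ} (hk : k + 1 ≤ N) {t : ℝ}
    (h1 : polarBoundary N k ≤ t) (h2 : t ≤ polarBoundary N (k + 1)) :
    dist (spiralPoint N (k + 1)) (spiralCurve N t) ≤ 4 / Real.sqrt N := by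
  have hN : 1 ≤ N := by omega
  have hN0 : (0 : ℝ) < N := by exact_mod_cast hN
  have hk1 : k + 1 ∈ Finset.Icc 1 N := Finset.mem_Icc.2 ⟨by omega, hk⟩
  have ht0 : 0 ≤ t := (Real.arccos_nonneg _).trans h1
  have htpi : t ≤ Real.pi := h2.trans (Real.arccos_le_pi _)
  have c1 : Real.cos t ≤ 1 - 2 * k / N := by
    rw [← cos_polarBoundary hN (by omega)]
    exact Real.cos_le_cos_of_nonneg_of_le_pi (Real.arccos_nonneg _) htpi h1
  have c2 : 1 - 2 * ((k + 1 : ℕ) : ℝ) / N ≤ Real.cos t := by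
    rw [← cos_polarBoundary hN hk]
    exact Real.cos_le_cos_of_nonneg_of_le_pi ht0 (Real.arccos_le_pi _) h2
  have hcos : |Real.cos (spiralPolar N (k + 1)) - Real.cos t| ≤ 1 / N := by
    rw [cos_spiralPolar hk1, spiralHeight]
    have e3 : (1 : ℝ) - (2 * ((k + 1 : ℕ) : ℝ) - 1) / N = 1 - 2 * k / N - 1 / N := by
      push_cast; field_simp; ring
    have e4 : (1 : ℝ) - 2 * ((k + 1 : ℕ) : ℝ) / N = 1 - 2 * k / N - 2 * (1 / N) := by
      push_cast; field_simp; ring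
    rw [e3, abs_le]
    constructor <;> linarith
  exact dist_spiralCurve_le hN (spiralPolar_mem N (k + 1)) ⟨ht0, htpi⟩ hcos

/-- A spiral point represents, up to the oscillation of `f` on sets of diameter
`O(1 / √N)`, the piece of the spiral over its height interval. -/
theorem abs_sub_integral_polarBoundary_le {N k : ℕ} (hk : k + 1 ≤ N) (f : C(S2, ℝ)) {ε η : ℝ}
    (hf : ∀ x y, dist x y < η → |f x - f y| ≤ ε) (hη : 4 / Real.sqrt N < η) :
    |2 / N * f (spiralPoint N (k + 1)) -
      ∫ t in (polarBoundary N k)..(polarBoundary N (k + 1)),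
        f (spiralCurve N t) * Real.sin t| ≤ 2 / N * ε := by
  have hc : Continuous fun t => f (spiralCurve N t) * Real.sin t :=
    (f.continuous.comp (continuous_spiralCurve N)).mul Real.continuous_sin
  have hsint := fun c : ℝ => (Real.continuous_sin.const_mul c).intervalIntegrable (μ := volume)
    (polarBoundary N k) (polarBoundary N (k + 1))
  have e : ∀ c : ℝ, 2 / N * c =
      ∫ t in (polarBoundary N k)..(polarBoundary N (k + 1)), c * Real.sin t := fun c => by
    rw [intervalIntegral.integral_const_mul, integral_sin_polarBoundary hk, mul_comm]
  rw [e, e, ← intervalIntegral.integral_sub (hsint _) (hc.intervalIntegrable _ _),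
    ← Real.norm_eq_abs]
  refine intervalIntegral.norm_integral_le_of_norm_le polarBoundary_mono
    (Eventually.of_forall fun t ht => ?_) (hsint _)
  have hst : 0 ≤ Real.sin t := Real.sin_nonneg_of_nonneg_of_le_pi
    ((Real.arccos_nonneg _).trans ht.1.le) (ht.2.trans (Real.arccos_le_pi _))
  rw [← sub_mul, norm_mul, Real.norm_eq_abs, Real.norm_of_nonneg hst]
  exact mul_le_mul_of_nonneg_right
    (hf _ _ ((dist_spiralPoint_spiralCurve_le hk ht.1.le ht.2).trans_lt hη)) hst

theorem abs_sub_integral_spiralCurve_le {N : ℕ} (hN : 1 ≤ N) (f : C(S2, ℝ)) {ε η : ℝ}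
    (hf : ∀ x y, dist x y < η → |f x - f y| ≤ ε) (hη : 4 / Real.sqrt N < η) :
    |2 * ∫ x, f x ∂(normalizedCounting N (spiralConfig N)) -
      ∫ t in (0 : ℝ)..Real.pi, f (spiralCurve N t) * Real.sin t| ≤ 2 * ε := by
  have hN0 : (N : ℝ) ≠ 0 := by exact_mod_cast (by omega : N ≠ 0)
  have hc : Continuous fun t => f (spiralCurve N t) * Real.sin t :=
    (f.continuous.comp (continuous_spiralCurve N)).mul Real.continuous_sin
  have hfirst : polarBoundary N 0 = 0 := by simp [polarBoundary]
  have hlast : polarBoundary N N = Real.pi := by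
    have : (1 : ℝ) - 2 * N / N = -1 := by field_simp; norm_num
    rw [polarBoundary, this, Real.arccos_neg_one]
  have hsum := intervalIntegral.sum_integral_adjacent_intervals (μ := volume) (n := N)
    (a := polarBoundary N) (f := fun t => f (spiralCurve N t) * Real.sin t)
    fun k _ => hc.intervalIntegrable _ _
  rw [hfirst, hlast] at hsum
  rw [integral_normalizedCounting_spiralConfig, ← hsum, ← mul_assoc, Finset.mul_sum,
    ← Finset.sum_sub_distrib, ← div_eq_mul_inv]
  calc _ ≤ ∑ k ∈ Finset.range N, 2 / N * ε :=
        (Finset.abs_sum_le_sum_abs _ _).trans (Finset.sum_le_sum fun k hk =>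
          abs_sub_integral_polarBoundary_le (Finset.mem_range.1 hk) f hf hη)
    _ = 2 * ε := by
        rw [Finset.sum_const, Finset.card_range, nsmul_eq_mul]
        field_simp

theorem isEquidistributed_spiralConfig : IsEquidistributed spiralConfig := by
  intro f
  have hdiff : Tendsto (fun N : ℕ => 2 * ∫ x, f x ∂(normalizedCounting N (spiralConfig N)) -
      ∫ t in (0 : ℝ)..Real.pi, f (spiralCurve N t) * Real.sin t) atTop (𝓝 0) := by
    rw [Metric.tendsto_atTop']
    intro ε hε
    obtain ⟨η, hη, h⟩ := Metric.uniformContinuous_iff.1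
      (CompactSpace.uniformContinuous_of_continuous f.continuous) (ε / 4) (by positivity)
    have hsmall : Tendsto (fun N : ℕ => 4 / Real.sqrt N) atTop (𝓝 0) :=
      tendsto_const_nhds.div_atTop (Real.tendsto_sqrt_atTop.comp tendsto_natCast_atTop_atTop)
    obtain ⟨N₀, hN₀⟩ := eventually_atTop.1 (hsmall.eventually (gt_mem_nhds hη))
    refine ⟨max N₀ 1, fun N hN => ?_⟩
    have h1 : N₀ < N := (le_max_left _ _).trans_lt hN
    have h2 : 1 < N := (le_max_right _ _).trans_lt hN
    have := abs_sub_integral_spiralCurve_le h2.le f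
      (fun x y hxy => by simpa [Real.dist_eq] using (h hxy).le) (hN₀ N h1.le)
    rw [Real.dist_eq, sub_zero]
    linarith
  have h := (hdiff.add (tendsto_integral_spiralCurve f)).const_mul (1 / 2)
  simpa using h

theorem theorem1 :
    IsConfigurationSequence spiralConfig ∧
    IsEquidistributed spiralConfig ∧
    IsQuasiUniform spiralConfig ∧
    Tendsto (fun N : ℕ => Real.sqrt N * separation (spiralConfig N)) atTop
      (𝓝 (Real.sqrt (8 - 4 * Real.sqrt 3 *
        Real.cos (Real.sqrt (2 * Real.pi) * (1 - Real.sqrt 3))))) ∧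
    |Real.sqrt (8 - 4 * Real.sqrt 3 *
        Real.cos (Real.sqrt (2 * Real.pi) * (1 - Real.sqrt 3))) - 3.131948| < 5 / 10 ^ 7 :=
  ⟨fun N _ => card_spiralConfig N, isEquidistributed_spiralConfig, isQuasiUniform_spiralConfig,
    tendsto_sqrt_mul_separation, separation_limit_approx⟩
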